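/- **Conventions.** Let $X$ be an arbitrary set. A concept or hypothesis is a function $X\to\{0,1\}$, and a class is a set of concepts. Distributions on $X$ and output distributions of randomized algorithms are discrete, i.e. countably supported and defined on all subsets (if $X$ is countable, this includes every distribution on $X$). For a distribution $\mu$ on $X$ put $\mathrm{error}_\mu(c,h)=\Pr_{x\sim\mu}[h(x)\ne c(x)]$. A learner with $m$ labeled and $u$ unlabeled examples is a randomized algorithm $A$ that maps each database in $(X\times\{0,1,\bot\})^{m+u}$ to a hypothesis. For a concept $c$ and a distribution $\mu$, let $D$ be the random database whose $m+u$ points are drawn i.i.d. from $\mu$, the first $m$ labeled by $c$ and the last $u$ labeled $\bot$. - $A$ is $(\epsilon,\delta)$-differentially private if $\Pr[A(S)\in E]\le e^{\epsilon}\Pr[A(S')\in E]+\delta$ for all sets $E$ of hypotheses and all databases $S,S'$ that differ in exactly one entry. - For a class $F$, $A$ is an $(\alpha,\beta,\epsilon,\delta)$-PSSL for $F$ if it is $(\epsilon,\delta)$-differentially private and, for all $c\in F$ and all $\mu$, $\Pr[\mathrm{error}_\mu(c,A(D))>\alpha]\le\beta$. - $A$ $(\alpha,\beta)$-competes with $F$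 if, for all concepts $c$ (not necessarily in $F$) and all $\mu$, $$\Pr\Big[\mathrm{error}_\mu(c,A(D))\le\inf_{f\in F}\mathrm{error}_\mu(c,f)+\alpha\Big]\ge 1-\beta .$$ - $A$ is an $(\alpha,\beta,\epsilon,\delta)$-agnostic-PSSL using $F$ if it is $(\epsilon,\delta)$-differentially private, $(\alpha,\beta)$-competes with $F$, and on every database outputs only hypotheses in $F$. $\mathrm{VC}(F)\in\{0,1,2,\dots\}\cup\{\infty\}$ denotes the VC dimension. **Theorem.** There are universal constants $\lambda,K>0$ such that the following holds for every set $X$, every class $F$ over $X$, all $\alpha,\beta\in(0,1)$, $\epsilon\in(0,1]$, $\delta\ge 0$ and every integer $n\ge 0$. Suppose that $A$ is an $(\alpha,\beta,1,\delta)$-PSSL for $F$ that uses $n$ examples, all of them labeled. Then there is an $(\epsilon,\delta)$-differentially private learner $B$ that uses $m$ labeled and $u$ unlabeled examples, where $$m\le K\,\frac{\mathrm{VC}(F)\,\log\frac1{\alpha\beta}}{\alpha^2\epsilon},\qquad u\le K\,\frac n\epsilon ,$$ and that $(\lambda\alpha,\lambda\beta)$-competes with $F$. Moreover, if $A$ is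 proper (on every database it outputs only hypotheses in $F$), then the same $B$ also outputs only hypotheses in $F$; that is, $B$ is a $(\lambda\alpha,\lambda\beta,\epsilon,\delta)$-agnostic-PSSL using $F$. (If $\mathrm{VC}(F)=\infty$, the bound on $m$ is vacuous.) -/

import Mathlib

open scoped ENNReal

namespace PrivateLearning

/-- A database of size `n` over the domain `X`: each entry is a point with a label in
`{0, 1, ⊥}`, where `none` stands for `⊥` (unlabeled). -/
abbrev Database (X : Type*) (n : ℕ) : Type _ := Fin n → X × Option Bool

/-- A randomized algorithm that maps a database of size `n` to a hypothesis `X → {0, 1}`: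
to each database it assigns the distribution of its output over its coin tosses. -/
abbrev Learner (X : Type*) (n : ℕ) : Type _ := Database X n → PMF (X → Bool)

/-- Two databases are neighboring if they differ in exactly one entry. -/
def Neighboring {Z : Type*} {n : ℕ} (S T : Fin n → Z) : Prop :=
  ∃ i, S i ≠ T i ∧ ∀ j, j ≠ i → S j = T j

/-- `(ε, δ)`-differential privacy. -/
def IsDP {Z O : Type*} {n : ℕ} (ε δ : ℝ) (A : (Fin n → Z) → PMF O) : Prop :=
  ∀ S T : Fin n → Z, Neighboring S T → ∀ E : Set O,
    (A S).toOuterMeasure E ≤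
      ENNReal.ofReal (Real.exp ε) * (A T).toOuterMeasure E + ENNReal.ofReal δ

/-- The generalization error `Pr_{x ∼ μ}[h(x) ≠ c(x)]`. -/
noncomputable def genError {X : Type*} (μ : PMF X) (c h : X → Bool) : ℝ≥0∞ :=
  μ.toOuterMeasure {x | h x ≠ c x}

/-- The distribution of `n` independent samples from `μ`. -/
noncomputable def iid {X : Type*} (μ : PMF X) : (n : ℕ) → PMF (Fin n → X)
  | 0 => PMF.pure Fin.elim0
  | n + 1 => μ.bind fun x => (iid μ n).map fun v => (Fin.cons x v : Fin (n + 1) → X)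

/-- The probability of a sample under `iid` is the product of the probabilities of its entries. -/
theorem iid_apply {X : Type*} (μ : PMF X) (n : ℕ) (v : Fin n → X) :
    iid μ n v = ∏ i, μ (v i) := by
  classical
  induction n with
  | zero => simp [iid, PMF.pure_apply, Subsingleton.elim v Fin.elim0]
  | succ n ih =>
    rw [Fin.prod_univ_succ, iid, PMF.bind_apply, tsum_eq_single (v 0)]
    · congr 1
      rw [PMF.map_apply, tsum_eq_single (Fin.tail v)]
      · simp [ih, Fin.tail]
      · intro w hw
        rw [if_neg]
        intro h
        apply hw
        rw [h]
        simp
    · intro x hx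
      rw [PMF.map_apply]
      have h0 : ∀ w : Fin n → X, ¬ v = Fin.cons x w := by
        intro w h
        apply hx
        rw [h]
        simp
      simp [h0]

/-- The database on the points `x` in which the first `m` entries are labeled by the
concept `c` and the remaining entries carry the label `⊥`. -/
def labelFirst {X : Type*} {n : ℕ} (m : ℕ) (c : X → Bool) (x : Fin n → X) : Database X n :=
  fun i => (x i, if (i : ℕ) < m then some (c (x i)) else none)

/-- The distribution of the hypothesis that `A` outputs on `n` i.i.d. samples from `μ`, the
first `m` of which are labeled by `c`; over both the sample and the coins of `A`. -/
noncomputable def outputDist {X : Type*} {n : ℕ} (A : Learner X n) (m : ℕ) (c : X → Bool)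
    (μ : PMF X) : PMF (X → Bool) :=
  (iid μ n).bind fun x => A (labelFirst m c x)

/-- `A` is an `(α, β, n, m)`-semi-supervised learner for the class `C`. -/
def IsSSL {X : Type*} {n : ℕ} (α β : ℝ) (m : ℕ) (C : Set (X → Bool)) (A : Learner X n) : Prop :=
  ∀ c ∈ C, ∀ μ : PMF X,
    (outputDist A m c μ).toOuterMeasure {h | ENNReal.ofReal α < genError μ c h} ≤
      ENNReal.ofReal β

/-- `A` is an `(α, β, ε, δ, n, m)`-private semi-supervised learner for the class `C`. -/
def IsPSSL {X : Type*} {n : ℕ} (α β ε δ : ℝ) (m : ℕ) (C : Set (X → Bool))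
    (A : Learner X n) : Prop :=
  IsSSL α β m C A ∧ IsDP ε δ A

/-- On every database, `A` only outputs hypotheses from `H`. -/
def OutputsIn {X : Type*} {n : ℕ} (H : Set (X → Bool)) (A : Learner X n) : Prop :=
  ∀ S : Database X n, (A S).support ⊆ H

/-- For every concept `c` (not necessarily in `H`) and every distribution `μ`, with probability
at least `1 - β` the error of the output of `A` exceeds the infimum of the errors of the
hypotheses in `H` by at most `α`. -/
def CompetesWith {X : Type*} {n : ℕ} (α β : ℝ) (m : ℕ) (H : Set (X → Bool))
    (A : Learner X n) : Prop :=
  ∀ (c : X → Bool) (μ : PMF X),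
    ENNReal.ofReal (1 - β) ≤ (outputDist A m c μ).toOuterMeasure
      {h | genError μ c h ≤ (⨅ f ∈ H, genError μ c f) + ENNReal.ofReal α}

/-- `A` is an `(α, β, n, m)`-agnostic semi-supervised learner using `H`. -/
def IsAgnosticSSL {X : Type*} {n : ℕ} (α β : ℝ) (m : ℕ) (H : Set (X → Bool))
    (A : Learner X n) : Prop :=
  OutputsIn H A ∧ CompetesWith α β m H A

/-- `A` is an `(α, β, ε, δ, n, m)`-agnostic private semi-supervised learner using `H`. -/
def IsAgnosticPSSL {X : Type*} {n : ℕ} (α β ε δ : ℝ) (m : ℕ) (H : Set (X → Bool))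
    (A : Learner X n) : Prop :=
  IsAgnosticSSL α β m H A ∧ IsDP ε δ A

/-- The finite set `B` of points is shattered by `C`. -/
def IsShattered {X : Type*} (C : Set (X → Bool)) (B : Finset X) : Prop :=
  ∀ z : X → Bool, ∃ c ∈ C, ∀ x ∈ B, c x = z x

/-- The VC dimension of `C`, possibly infinite. -/
noncomputable def vcDim {X : Type*} (C : Set (X → Bool)) : ℕ∞ :=
  ⨆ (B : Finset X) (_ : IsShattered C B), (B.card : ℕ∞)

end PrivateLearning

open PrivateLearning

/-! Labels are needed only to single out a good member of `F`; the example-hungry learner `A` can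
run on unlabeled points that have been labeled privately. A labeled sample of size `s` about `VC(F)
log(1/αβ)/α²` identifies nearly optimal members of `F` by uniform convergence, and an exponential
mechanism over the labelings that `F` realizes on further points (few, by Sauer–Shelah) transfers
such a member to them. Labeling about `n` points at once would force `s` to grow with `log n`, so
the labeled set is doubled repeatedly, from `s * 2 ^ i` to `s * 2 ^ (i + 1)` points. After the first
step the labels are realizable by `F`, multiplicative deviation bounds apply, and the losses of the
levels, about `α(i+1)/2^i` and `β/2^i`, have bounded sums (`IsRobustLearner.relabelThen`,
`exists_isRobustLearner`).

Privacy does not degrade with the number of levels. A changed labeled example is felt only through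
the weights of the next mechanism, after which everything is post-processing: a factor 4. A changed
unlabeled point perturbs one mechanism (factor 4) and one labeled entry of the learner that follows
(factor at most 8), in total 32. Drawing each entry from about `32/ε` candidates turns 32 into `e^ε`
(`subsampleLearner_isDP`).

The labeling chosen at a level depends on the points labeled, so `IsRobustLearner` asks for accuracy
with the supremum over targets inside the expectation. At the last level `A` runs on `n` draws from
the empirical distribution of at least `2n` points. Its guarantee holds for that distribution and
any target. Generalization follows because the output depends only on the drawn points and their
labels: a union bound over these labelings, followed by uniform convergence of `F` xor a fixed
output on the undrawn points, needs no bound on the complexity of the outputs of `A`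
(`expect_exists_generalize_le`). -/

namespace PrivateLearning

/-! ### Expectations of `ℝ≥0∞`-valued functions under discrete distributions. -/

/-- The expectation of an extended nonnegative function under a discrete distribution. -/
noncomputable def expect {α : Type*} (p : PMF α) (f : α → ℝ≥0∞) : ℝ≥0∞ := ∑' a, p a * f a

open Classical in
/-- The indicator of a proposition. -/
noncomputable def ind (P : Prop) : ℝ≥0∞ := if P then 1 else 0

theorem ind_true {P : Prop} (h : P) : ind P = 1 := if_pos h

theorem ind_false {P : Prop} (h : ¬ P) : ind P = 0 := if_neg h

theorem ind_le_one (P : Prop) : ind P ≤ 1 := by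
  unfold ind; split_ifs <;> simp

theorem ind_mono {P Q : Prop} (h : P → Q) : ind P ≤ ind Q := by
  by_cases hP : P
  · rw [ind_true hP, ind_true (h hP)]
  · rw [ind_false hP]; exact zero_le

theorem ind_le_of {P : Prop} {x : ℝ≥0∞} (h : P → 1 ≤ x) : ind P ≤ x := by
  by_cases hP : P
  · rw [ind_true hP]; exact h hP
  · rw [ind_false hP]; exact zero_le

theorem ind_le_add {P Q R : Prop} (h : P → Q ∨ R) : ind P ≤ ind Q + ind R := by
  refine ind_le_of fun hP => ?_
  rcases h hP with h | h
  · rw [ind_true h]; exact le_self_add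
  · rw [ind_true h]; exact le_add_self

theorem toOuterMeasure_eq_expect {α : Type*} (p : PMF α) (E : Set α) :
    p.toOuterMeasure E = expect p fun a => ind (a ∈ E) := by
  classical
  rw [PMF.toOuterMeasure_apply, expect]
  refine tsum_congr fun a => ?_
  by_cases h : a ∈ E <;> simp [h, ind]

theorem expect_mono {α : Type*} (p : PMF α) {f g : α → ℝ≥0∞} (h : ∀ a, f a ≤ g a) :
    expect p f ≤ expect p g :=
  ENNReal.tsum_le_tsum fun a => mul_le_mul_right (h a) _

theorem expect_const {α : Type*} (p : PMF α) (c : ℝ≥0∞) : (expect p fun _ => c) = c := by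
  rw [expect, ENNReal.tsum_mul_right, p.tsum_coe, one_mul]

theorem expect_le_of_le {α : Type*} (p : PMF α) {f : α → ℝ≥0∞} {c : ℝ≥0∞} (h : ∀ a, f a ≤ c) :
    expect p f ≤ c :=
  (expect_mono p h).trans (expect_const p c).le

theorem expect_add {α : Type*} (p : PMF α) (f g : α → ℝ≥0∞) :
    (expect p fun a => f a + g a) = expect p f + expect p g := by
  simp only [expect, mul_add, ENNReal.tsum_add]

theorem expect_const_mul {α : Type*} (p : PMF α) (c : ℝ≥0∞) (f : α → ℝ≥0∞) :
    (expect p fun a => c * f a) = c * expect p f := by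
  simp only [expect, ← ENNReal.tsum_mul_left]
  exact tsum_congr fun a => by ring

theorem expect_mul_const {α : Type*} (p : PMF α) (c : ℝ≥0∞) (f : α → ℝ≥0∞) :
    (expect p fun a => f a * c) = expect p f * c := by
  simp only [mul_comm _ c, expect_const_mul]

theorem expect_finset_sum {α ι : Type*} (p : PMF α) (s : Finset ι) (f : ι → α → ℝ≥0∞) :
    (expect p fun a => ∑ i ∈ s, f i a) = ∑ i ∈ s, expect p (f i) := by
  classical
  induction s using Finset.induction_on with
  | empty => simp [expect]
  | insert i s hi ih => simp only [Finset.sum_insert hi, expect_add, ih]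

theorem expect_comm {α β : Type*} (p : PMF α) (q : PMF β) (f : α → β → ℝ≥0∞) :
    (expect p fun a => expect q fun b => f a b) = expect q fun b => expect p fun a => f a b := by
  simp only [expect, ← ENNReal.tsum_mul_left]
  rw [ENNReal.tsum_comm]
  exact tsum_congr fun a => tsum_congr fun b => by ring

theorem expect_bind {α β : Type*} (p : PMF α) (q : α → PMF β) (f : β → ℝ≥0∞) :
    expect (p.bind q) f = expect p fun a => expect (q a) f := by
  simp only [expect, PMF.bind_apply, ← ENNReal.tsum_mul_left, ← ENNReal.tsum_mul_right]
  rw [ENNReal.tsum_comm]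
  exact tsum_congr fun a => tsum_congr fun b => by ring

theorem expect_pure {α : Type*} (a : α) (f : α → ℝ≥0∞) : expect (PMF.pure a) f = f a := by
  classical
  rw [expect, tsum_eq_single a]
  · simp
  · intro b hb; simp [PMF.pure_apply, hb]

theorem expect_map {α β : Type*} (p : PMF α) (g : α → β) (f : β → ℝ≥0∞) :
    expect (p.map g) f = expect p fun a => f (g a) := by
  rw [PMF.map, expect_bind]
  simp [expect_pure]

theorem expect_equiv {α β : Type*} (p : PMF α) (q : PMF β) (e : α ≃ β)
    (h : ∀ a, p a = q (e a)) (f : β → ℝ≥0∞) : expect q f = expect p fun a => f (e a) := by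
  simp only [expect, h]
  exact (e.tsum_eq fun b => q b * f b).symm

theorem expect_ind_not {α : Type*} (p : PMF α) (P : α → Prop) :
    (expect p fun a => ind (P a)) + (expect p fun a => ind (¬ P a)) = 1 := by
  rw [← expect_add, ← expect_const p 1]
  congr 1; ext a
  by_cases h : P a <;> simp [ind, h]

theorem expect_iid_succ {X : Type*} (μ : PMF X) (n : ℕ) (f : (Fin (n + 1) → X) → ℝ≥0∞) :
    expect (iid μ (n + 1)) f = expect μ fun x => expect (iid μ n) fun v => f (Fin.cons x v) := by
  rw [iid, expect_bind]
  simp only [expect_map]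

/-! ### Product distributions over arbitrary finite index types. -/

/-- The distribution of a family of independent samples from `μ`, indexed by a finite type. -/
noncomputable def prodPMF {X : Type*} (μ : PMF X) (ι : Type*) [Fintype ι] : PMF (ι → X) :=
  (iid μ (Fintype.card ι)).map fun v i => v (Fintype.equivFin ι i)

theorem expect_prodPMF {X ι : Type*} [Fintype ι] (μ : PMF X) (f : (ι → X) → ℝ≥0∞) :
    expect (prodPMF μ ι) f =
      expect (iid μ (Fintype.card ι)) fun v => f fun i => v (Fintype.equivFin ι i) := by
  rw [prodPMF, expect_map]

theorem prodPMF_apply {X ι : Type*} [Fintype ι] (μ : PMF X) (v : ι → X) :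
    prodPMF μ ι v = ∏ i, μ (v i) := by
  classical
  rw [prodPMF, PMF.map_apply, tsum_eq_single (fun j => v ((Fintype.equivFin ι).symm j))]
  · rw [if_pos (by ext; simp), iid_apply]
    exact Fintype.prod_equiv (Fintype.equivFin ι).symm _ _ fun _ => rfl
  · intro w hw
    rw [if_neg]
    rintro rfl
    exact hw (by ext; simp)

theorem iid_eq_prodPMF {X : Type*} (μ : PMF X) (n : ℕ) : iid μ n = prodPMF μ (Fin n) := by
  ext v
  rw [iid_apply, prodPMF_apply]

theorem expect_prodPMF_reindex {X ι κ : Type*} [Fintype ι] [Fintype κ] (μ : PMF X) (e : ι ≃ κ)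
    (f : (ι → X) → ℝ≥0∞) :
    expect (prodPMF μ ι) f = expect (prodPMF μ κ) fun v => f fun i => v (e i) := by
  refine expect_equiv (prodPMF μ κ) (prodPMF μ ι) (Equiv.arrowCongr e (Equiv.refl X)).symm ?_ f
  intro v
  simp only [prodPMF_apply]
  exact (Fintype.prod_equiv e _ _ fun _ => rfl).symm

theorem expect_prodPMF_sum {X ι κ : Type*} [Fintype ι] [Fintype κ] (μ : PMF X)
    (f : (ι ⊕ κ → X) → ℝ≥0∞) :
    expect (prodPMF μ (ι ⊕ κ)) f =
      expect (prodPMF μ ι) fun v => expect (prodPMF μ κ) fun w => f (Sum.elim v w) := by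
  simp only [expect, ← ENNReal.tsum_mul_left]
  rw [← ENNReal.tsum_prod, ← (Equiv.sumArrowEquivProdArrow ι κ X).symm.tsum_eq]
  refine tsum_congr fun v => ?_
  simp [prodPMF_apply, Fintype.prod_sum_type, Equiv.sumArrowEquivProdArrow, mul_assoc]

/-- Distinct coordinates of an i.i.d. family are again i.i.d.; the coordinates outside the range of
`j` integrate out. -/
theorem expect_prodPMF_comp_injective {X ι κ : Type*} [Fintype ι] [Fintype κ] (μ : PMF X)
    (j : κ → ι) (hj : Function.Injective j) (f : (κ → X) → ℝ≥0∞) :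
    (expect (prodPMF μ ι) fun v => f fun k => v (j k)) = expect (prodPMF μ κ) f := by
  classical
  let e : κ ⊕ {i // i ∉ Set.range j} ≃ ι :=
    ((Equiv.ofInjective j hj).sumCongr (Equiv.refl _)).trans (Equiv.sumCompl (· ∈ Set.range j))
  rw [expect_prodPMF_reindex μ e.symm, expect_prodPMF_sum]
  have he : ∀ k, e (Sum.inl k) = j k := fun k => rfl
  refine congrArg _ (funext fun v => ?_)
  simp only [← he, Equiv.symm_apply_apply, Sum.elim_inl]
  exact expect_const _ _

theorem expect_iid_prod {X : Type*} (μ : PMF X) (n : ℕ) (f : X → ℝ≥0∞) :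
    (expect (iid μ n) fun v => ∏ i, f (v i)) = expect μ f ^ n := by
  induction n with
  | zero => simp [expect_const]
  | succ n ih =>
    simp only [expect_iid_succ, Fin.prod_univ_succ, Fin.cons_zero, Fin.cons_succ,
      expect_const_mul, ih, expect_mul_const]
    ring

theorem expect_prodPMF_prod {X ι : Type*} [Fintype ι] (μ : PMF X) (f : X → ℝ≥0∞) :
    (expect (prodPMF μ ι) fun v => ∏ i, f (v i)) = expect μ f ^ Fintype.card ι := by
  rw [expect_prodPMF, ← expect_iid_prod]
  refine congrArg _ (funext fun v => ?_)
  exact Fintype.prod_equiv (Fintype.equivFin ι) _ _ fun _ => rfl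

theorem iid_map {X Y : Type*} (μ : PMF X) (g : X → Y) (n : ℕ) :
    iid (μ.map g) n = (iid μ n).map fun v i => g (v i) := by
  induction n with
  | zero =>
    simp only [iid, PMF.pure_map]
    congr 1; ext i; exact i.elim0
  | succ n ih =>
    simp only [iid, ih, PMF.bind_map, PMF.map_bind, PMF.map_comp, Function.comp_def]
    congr 1; ext1 x; congr 1; ext v i
    refine Fin.cases ?_ (fun i => ?_) i <;> simp

theorem toOuterMeasure_bind_eq {α β : Type*} (p : PMF α) (q : α → PMF β) (E : Set β) :
    (p.bind q).toOuterMeasure E = expect p fun a => (q a).toOuterMeasure E := by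
  simp only [toOuterMeasure_eq_expect, expect_bind]

/-! ### Patterns on finite point families and the Sauer–Shelah bound. -/

open Classical in
/-- The patterns that the functions in `G` realize on the points `w`. -/
noncomputable def patterns {X κ : Type*} [Fintype κ] (G : Set (X → Bool)) (w : κ → X) :
    Finset (κ → Bool) :=
  Finset.univ.filter fun π => ∃ g ∈ G, ∀ k, g (w k) = π k

theorem mem_patterns {X κ : Type*} [Fintype κ] {G : Set (X → Bool)} {w : κ → X} {π : κ → Bool} :
    π ∈ patterns G w ↔ ∃ g ∈ G, ∀ k, g (w k) = π k := by
  simp [patterns]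

/-- The Sauer–Shelah bound on the number of patterns on `k` points in VC dimension `d`. -/
def growth (d k : ℕ) : ℕ := ∑ i ∈ Finset.range (d + 1), k.choose i

theorem growth_mono (d : ℕ) {k l : ℕ} (h : k ≤ l) : growth d k ≤ growth d l :=
  Finset.sum_le_sum fun _ _ => Nat.choose_le_choose _ h

theorem one_le_growth (d k : ℕ) : 1 ≤ growth d k := by
  unfold growth
  rw [Finset.sum_range_succ']
  simp

theorem card_le_vcDim {X : Type*} {F : Set (X → Bool)} {B : Finset X} (h : IsShattered F B) :
    (B.card : ℕ∞) ≤ vcDim F :=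
  le_iSup₂ (f := fun (B : Finset X) (_ : IsShattered F B) => (B.card : ℕ∞)) B h

/-- Mathlib's Sauer–Shelah lemma is applied to the index sets on which patterns are true. A
shattered index set cannot repeat a point, since a repeated point receives a single value; hence its
image under `w` is a shattered set of the same size. -/
theorem card_patterns_le {X κ : Type*} [Fintype κ] {F : Set (X → Bool)} {d : ℕ}
    (hd : vcDim F ≤ d) (w : κ → X) : (patterns F w).card ≤ growth d (Fintype.card κ) := by
  classical
  let toSet : (κ → Bool) → Finset κ := fun π => Finset.univ.filter fun k => π k = true
  have hinj : Function.Injective toSet := by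
    intro π ρ h
    ext k
    have := congrArg (fun s => k ∈ s) h
    simp only [toSet, Finset.mem_filter, Finset.mem_univ, true_and, eq_iff_iff] at this
    exact Bool.eq_iff_iff.2 this ▸ rfl
  let 𝒜 := (patterns F w).image toSet
  have hcard : 𝒜.card = (patterns F w).card := Finset.card_image_of_injective _ hinj
  have hvc : 𝒜.vcDim ≤ d := by
    refine Finset.sup_le fun s hs => ?_
    rw [Finset.mem_shatterer] at hs
    have key : ∀ t ⊆ s, ∃ f ∈ F, ∀ k ∈ s, (f (w k) = true ↔ k ∈ t) := by
      intro t ht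
      obtain ⟨u, hu, hut⟩ := hs ht
      obtain ⟨π, hπ, rfl⟩ := Finset.mem_image.1 hu
      obtain ⟨f, hf, hfπ⟩ := mem_patterns.1 hπ
      refine ⟨f, hf, fun k hk => ?_⟩
      rw [hfπ, ← hut]
      simp [toSet, hk]
    have hwinj : Set.InjOn w s := by
      intro i hi j hj hij
      by_contra hne
      obtain ⟨f, -, hf⟩ := key {i} (by simpa using hi)
      have h1 := (hf i hi).2 (by simp)
      rw [hij] at h1
      have := (hf j hj).1 h1
      simp only [Finset.mem_singleton] at this
      exact hne this.symm
    have hsh : IsShattered F (s.image w) := by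
      intro z
      obtain ⟨f, hf, hfs⟩ := key (s.filter fun k => z (w k) = true) (Finset.filter_subset _ _)
      refine ⟨f, hf, fun x hx => ?_⟩
      obtain ⟨k, hk, rfl⟩ := Finset.mem_image.1 hx
      have := hfs k hk
      simp only [Finset.mem_filter, hk, true_and] at this
      exact Bool.eq_iff_iff.2 this
    have := (card_le_vcDim hsh).trans hd
    rw [Finset.card_image_of_injOn hwinj] at this
    exact_mod_cast this
  rw [← hcard]
  refine (Finset.card_le_card_shatterer 𝒜).trans (Finset.card_shatterer_le_sum_vcDim.trans ?_)
  unfold growth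
  refine Finset.sum_le_sum_of_subset fun i hi => ?_
  simp only [Finset.mem_Iic, Finset.mem_range] at hi ⊢
  omega

/-- Each term is multiplied by `(k/d)^d (d/k)^i ≥ 1`; the binomial theorem then sums them to at most
`(k/d)^d (1 + d/k)^k`. -/
theorem growth_le {d k : ℕ} (hd : 0 < d) (hk : d ≤ k) :
    (growth d k : ℝ) ≤ (Real.exp 1 * k / d) ^ d := by
  have hd' : (0 : ℝ) < d := by exact_mod_cast hd
  have hk' : (0 : ℝ) < k := by exact_mod_cast hd.trans_le hk
  have hdk : (d : ℝ) ≤ k := by exact_mod_cast hk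
  have hone : 1 ≤ (k : ℝ) / d := (one_le_div hd').2 hdk
  have h1 : (growth d k : ℝ) ≤ (k / d : ℝ) ^ d * (1 + d / k) ^ k := by
    have : ((1 : ℝ) + d / k) ^ k = ∑ i ∈ Finset.range (k + 1), (d / k : ℝ) ^ i * k.choose i := by
      rw [add_comm, add_pow]; simp
    rw [this, Finset.mul_sum, growth]
    push_cast
    refine le_trans ?_ (Finset.sum_le_sum_of_subset_of_nonneg
      (Finset.range_mono (by omega : d + 1 ≤ k + 1)) fun i _ _ => by positivity)
    refine Finset.sum_le_sum fun i hi => ?_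
    have hi' : i ≤ d := by simpa [Nat.lt_succ_iff] using hi
    have : (1 : ℝ) ≤ (k / d : ℝ) ^ d * (d / k) ^ i := by
      have h2 : (d / k : ℝ) ^ i = ((k / d : ℝ) ^ i)⁻¹ := by rw [← inv_pow, inv_div]
      rw [h2, ← div_eq_mul_inv, one_le_div (by positivity)]
      exact pow_le_pow_right₀ hone hi'
    calc (k.choose i : ℝ) = 1 * k.choose i := (one_mul _).symm
      _ ≤ _ := by rw [← mul_assoc]; gcongr
  have h2 : (1 + d / k : ℝ) ^ k ≤ Real.exp 1 ^ d := by
    calc (1 + d / k : ℝ) ^ k ≤ Real.exp (d / k) ^ k := by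
          gcongr; rw [add_comm]; exact Real.add_one_le_exp _
      _ = Real.exp 1 ^ d := by
          rw [← Real.exp_nat_mul, ← Real.exp_nat_mul]; congr 1; field_simp
  calc (growth d k : ℝ) ≤ (k / d : ℝ) ^ d * (1 + d / k) ^ k := h1
    _ ≤ (k / d : ℝ) ^ d * Real.exp 1 ^ d := by gcongr
    _ = _ := by rw [← mul_pow]; congr 1; ring

/-! ### Symmetrization and uniform convergence. -/

/-- The real value of a Boolean. -/
def bval (b : Bool) : ℝ := if b then 1 else 0

theorem bval_nonneg (b : Bool) : 0 ≤ bval b := by unfold bval; split_ifs <;> norm_num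

theorem bval_le_one (b : Bool) : bval b ≤ 1 := by unfold bval; split_ifs <;> norm_num

/-- The number of indices where a pattern is true. -/
def count {κ : Type*} [Fintype κ] (π : κ → Bool) : ℝ := ∑ k, bval (π k)

theorem count_nonneg {κ : Type*} [Fintype κ] (π : κ → Bool) : 0 ≤ count π :=
  Finset.sum_nonneg fun _ _ => bval_nonneg _

/-- A Chernoff bound for random swaps within pairs. The combined count `c` is invariant under
swapping and bounds the variance, so the deviation is measured against `√(τ c)` instead of the
number of pairs; this makes the later bounds multiplicative. -/
theorem sum_sign_le {ι : Type*} [Fintype ι] [DecidableEq ι] (x y : ι → Bool) {τ : ℝ} (hτ : 0 ≤ τ)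
    (P : (ι → Bool) → Prop) [DecidablePred P]
    (hP : ∀ σ, P σ → (∑ i, if σ i then bval (y i) else bval (x i)) <
        (∑ i, if σ i then bval (x i) else bval (y i)) ∧
      τ * ((∑ i, if σ i then bval (y i) else bval (x i)) +
          ∑ i, if σ i then bval (x i) else bval (y i)) ≤
        ((∑ i, if σ i then bval (x i) else bval (y i)) -
          ∑ i, if σ i then bval (y i) else bval (x i)) ^ 2) :
    (∑ σ : ι → Bool, if P σ then (1 : ℝ) else 0) ≤ 2 ^ Fintype.card ι * Real.exp (-τ / 2) := by
  set c : ℝ := ∑ i, (bval (x i) + bval (y i)) with hc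
  have hc0 : 0 ≤ c := Finset.sum_nonneg fun i _ => add_nonneg (bval_nonneg _) (bval_nonneg _)
  have hsum : ∀ σ : ι → Bool, (∑ i, if σ i then bval (y i) else bval (x i)) +
      (∑ i, if σ i then bval (x i) else bval (y i)) = c := by
    intro σ
    rw [← Finset.sum_add_distrib]
    refine Finset.sum_congr rfl fun i _ => ?_
    split_ifs <;> ring
  rcases hc0.eq_or_lt with h0 | hcpos
  · have : ∀ σ, ¬ P σ := by
      intro σ hσ
      have h1 := (hP σ hσ).1
      have h2 : 0 ≤ ∑ i, if σ i then bval (y i) else bval (x i) :=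
        Finset.sum_nonneg fun i _ => by split_ifs <;> exact bval_nonneg _
      have := hsum σ
      have h3 : 0 ≤ ∑ i, if σ i then bval (x i) else bval (y i) :=
        Finset.sum_nonneg fun i _ => by split_ifs <;> exact bval_nonneg _
      linarith
    simp only [this, if_false, Finset.sum_const_zero]
    positivity
  -- This tilt makes `l √(τ c) = τ`, while the moment generating function contributes only `l² c / 2
  -- = τ / 2`.
  set l : ℝ := √(τ / c) with hl
  have hl0 : 0 ≤ l := Real.sqrt_nonneg _
  have hl2 : l ^ 2 * c = τ := by
    rw [hl, Real.sq_sqrt (by positivity)]; field_simp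
  have hpt : ∀ σ : ι → Bool, (if P σ then (1 : ℝ) else 0) ≤
      Real.exp (-τ) * ∏ i, Real.exp (l * (if σ i then bval (x i) - bval (y i)
        else bval (y i) - bval (x i))) := by
    intro σ
    split_ifs with hσ
    · obtain ⟨h1, h2⟩ := hP σ hσ
      rw [← Real.exp_sum, ← Real.exp_add, ← Finset.mul_sum]
      refine Real.one_le_exp ?_
      have h3 : (∑ i, if σ i then bval (x i) - bval (y i) else bval (y i) - bval (x i)) =
          (∑ i, if σ i then bval (x i) else bval (y i)) -
            ∑ i, if σ i then bval (y i) else bval (x i) := by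
        rw [← Finset.sum_sub_distrib]
        refine Finset.sum_congr rfl fun i _ => ?_
        split_ifs <;> ring
      rw [h3]
      rw [hsum] at h2
      set D := (∑ i, if σ i then bval (x i) else bval (y i)) -
            ∑ i, if σ i then bval (y i) else bval (x i)
      have hD : 0 < D := by simp only [D]; linarith
      have : l * c ≤ D := by
        refine abs_le_of_sq_le_sq' ?_ hD.le |>.2
        calc (l * c) ^ 2 = (l ^ 2 * c) * c := by ring
          _ = τ * c := by rw [hl2]
          _ ≤ D ^ 2 := h2
      have : l * (l * c) ≤ l * D := by gcongr
      nlinarith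
    · positivity
  calc (∑ σ : ι → Bool, if P σ then (1 : ℝ) else 0)
      ≤ ∑ σ : ι → Bool, Real.exp (-τ) * ∏ i, Real.exp (l * (if σ i then bval (x i) - bval (y i)
        else bval (y i) - bval (x i))) := Finset.sum_le_sum fun σ _ => hpt σ
    _ = Real.exp (-τ) * ∏ i : ι, ∑ b : Bool, Real.exp (l * (if b then bval (x i) - bval (y i)
        else bval (y i) - bval (x i))) := by
        rw [← Finset.mul_sum, Finset.prod_univ_sum, Fintype.piFinset_univ]
    _ ≤ Real.exp (-τ) * ∏ i : ι, (2 * Real.exp (l ^ 2 / 2 * (bval (x i) + bval (y i)))) := by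
        gcongr with i
        have h1 := Real.cosh_le_exp_half_sq (l * (bval (x i) - bval (y i)))
        rw [Real.cosh_eq] at h1
        have h2 : (l * (bval (x i) - bval (y i))) ^ 2 / 2 ≤
            l ^ 2 / 2 * (bval (x i) + bval (y i)) := by
          -- Booleans make the squared difference at most the sum: the variance is controlled by the
          -- count.
          have : (bval (x i) - bval (y i)) ^ 2 ≤ bval (x i) + bval (y i) := by
            cases x i <;> cases y i <;> norm_num [bval]
          have h0 : 0 ≤ l ^ 2 / 2 := by positivity
          nlinarith
        have h3 := h1.trans (Real.exp_le_exp.2 h2)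
        have h4 : l * (bval (y i) - bval (x i)) = -(l * (bval (x i) - bval (y i))) := by ring
        simp only [Fintype.sum_bool, if_true, Bool.false_eq_true, if_false, h4]
        linarith
    _ = 2 ^ Fintype.card ι * Real.exp (-τ / 2) := by
        rw [Finset.prod_mul_distrib, ← Real.exp_sum, ← Finset.mul_sum, ← hc]
        simp only [Finset.prod_const, Finset.card_univ]
        rw [mul_left_comm, ← Real.exp_add]
        congr 2
        linarith

/-- The permutation of `ι ⊕ ι` that exchanges the two copies of the indices chosen by `σ`. -/
def swapPerm {ι : Type*} (σ : ι → Bool) : ι ⊕ ι ≃ ι ⊕ ι where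
  toFun := Sum.elim (fun i => if σ i then Sum.inr i else Sum.inl i)
    (fun i => if σ i then Sum.inl i else Sum.inr i)
  invFun := Sum.elim (fun i => if σ i then Sum.inr i else Sum.inl i)
    (fun i => if σ i then Sum.inl i else Sum.inr i)
  left_inv := by rintro (i | i) <;> cases h : σ i <;> simp [h]
  right_inv := by rintro (i | i) <;> cases h : σ i <;> simp [h]

/-- If a random swap of the two halves rarely produces a pattern with property `C`, then a
double sample rarely admits a function in `G` whose pattern has property `C`. -/
theorem expect_exists_pattern_le {X ι : Type*} [Fintype ι] (μ : PMF X) (G : Set (X → Bool)) (N : ℕ)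
    (hN : ∀ w : ι ⊕ ι → X, (patterns G w).card ≤ N) (C : (ι ⊕ ι → Bool) → Prop) (b : ℝ≥0∞)
    (hC : ∀ π : ι ⊕ ι → Bool,
      (∑ᶠ σ : ι → Bool, ind (C fun k => π (swapPerm σ k))) ≤ 2 ^ Fintype.card ι * b) :
    (expect (prodPMF μ (ι ⊕ ι)) fun w => ind (∃ g ∈ G, C fun k => g (w k))) ≤ N * b := by
  classical
  simp only [finsum_eq_sum_of_fintype] at hC
  have hσ : ∀ σ : ι → Bool,
      (expect (prodPMF μ (ι ⊕ ι)) fun w => ind (∃ g ∈ G, C fun k => g (w k))) =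
        expect (prodPMF μ (ι ⊕ ι)) fun w => ind (∃ g ∈ G, C fun k => g (w (swapPerm σ k))) :=
    fun σ => expect_prodPMF_reindex μ (swapPerm σ) _
  have hw : ∀ w : ι ⊕ ι → X, (∑ σ : ι → Bool, ind (∃ g ∈ G, C fun k => g (w (swapPerm σ k)))) ≤
      N * (2 ^ Fintype.card ι * b) := by
    intro w
    calc (∑ σ : ι → Bool, ind (∃ g ∈ G, C fun k => g (w (swapPerm σ k))))
        ≤ ∑ σ : ι → Bool, ∑ π ∈ patterns G w, ind (C fun k => π (swapPerm σ k)) := by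
          refine Finset.sum_le_sum fun σ _ => ind_le_of ?_
          rintro ⟨g, hg, h⟩
          have := Finset.single_le_sum (f := fun π : ι ⊕ ι → Bool => ind (C fun k =>
            π (swapPerm σ k))) (s := patterns G w) (a := fun k => g (w k))
            (fun _ _ => zero_le) (mem_patterns.2 ⟨g, hg, fun k => rfl⟩)
          rw [ind_true h] at this
          exact this
      _ = ∑ π ∈ patterns G w, ∑ σ : ι → Bool, ind (C fun k => π (swapPerm σ k)) :=
          Finset.sum_comm
      _ ≤ ∑ π ∈ patterns G w, 2 ^ Fintype.card ι * b := Finset.sum_le_sum fun π _ => hC π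
      _ ≤ _ := by
          rw [Finset.sum_const, nsmul_eq_mul]
          gcongr
          exact hN w
  have htot : (2 : ℝ≥0∞) ^ Fintype.card ι *
      (expect (prodPMF μ (ι ⊕ ι)) fun w => ind (∃ g ∈ G, C fun k => g (w k))) ≤
      2 ^ Fintype.card ι * (N * b) := by
    calc (2 : ℝ≥0∞) ^ Fintype.card ι *
        (expect (prodPMF μ (ι ⊕ ι)) fun w => ind (∃ g ∈ G, C fun k => g (w k)))
        = ∑ σ : ι → Bool, expect (prodPMF μ (ι ⊕ ι)) fun w =>
            ind (∃ g ∈ G, C fun k => g (w (swapPerm σ k))) := by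
          simp only [← hσ]
          simp
      _ = expect (prodPMF μ (ι ⊕ ι)) fun w => ∑ σ : ι → Bool,
            ind (∃ g ∈ G, C fun k => g (w (swapPerm σ k))) := (expect_finset_sum _ _ _).symm
      _ ≤ N * (2 ^ Fintype.card ι * b) := expect_le_of_le _ hw
      _ = _ := by ring
  exact (ENNReal.mul_le_mul_iff_right (by positivity) (by finiteness)).1 htot

/-- Symmetrization: on a sample and an independent copy of it, the counts of all functions in `G`
are close. -/
theorem expect_double_sample_le {X ι : Type*} [Fintype ι] (μ : PMF X) (G : Set (X → Bool)) (N : ℕ)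
    (hN : ∀ w : ι ⊕ ι → X, (patterns G w).card ≤ N) {τ : ℝ} (hτ : 0 ≤ τ) :
    (expect (prodPMF μ ι) fun v => expect (prodPMF μ ι) fun v' =>
      ind (∃ g ∈ G, count (fun i => g (v i)) < count (fun i => g (v' i)) ∧
        τ * (count (fun i => g (v i)) + count (fun i => g (v' i))) ≤
          (count (fun i => g (v' i)) - count (fun i => g (v i))) ^ 2)) ≤
      N * ENNReal.ofReal (Real.exp (-τ / 2)) := by
  classical
  have h := expect_exists_pattern_le μ G N hN (fun π =>
    count (fun i => π (Sum.inl i)) < count (fun i => π (Sum.inr i)) ∧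
      τ * (count (fun i => π (Sum.inl i)) + count (fun i => π (Sum.inr i))) ≤
        (count (fun i => π (Sum.inr i)) - count (fun i => π (Sum.inl i))) ^ 2)
    (ENNReal.ofReal (Real.exp (-τ / 2))) (by
      intro π
      have := sum_sign_le (fun i => π (Sum.inl i)) (fun i => π (Sum.inr i)) hτ _
        (fun σ h => h)
      rw [finsum_eq_sum_of_fintype]
      refine le_trans ?_ ((ENNReal.ofReal_le_ofReal this).trans (le_of_eq ?_))
      · rw [ENNReal.ofReal_sum_of_nonneg (fun σ _ => by split_ifs <;> norm_num)]
        refine Finset.sum_le_sum fun σ _ => ?_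
        have e1 : ∀ i, bval (π (swapPerm σ (Sum.inl i))) =
            if σ i then bval (π (Sum.inr i)) else bval (π (Sum.inl i)) := by
          intro i; cases h : σ i <;> simp [swapPerm, h]
        have e2 : ∀ i, bval (π (swapPerm σ (Sum.inr i))) =
            if σ i then bval (π (Sum.inl i)) else bval (π (Sum.inr i)) := by
          intro i; cases h : σ i <;> simp [swapPerm, h]
        refine ind_le_of fun h => ?_
        simp only [count, e1, e2] at h
        rw [if_pos h]
        simp
      · rw [ENNReal.ofReal_mul (by positivity), ENNReal.ofReal_pow (by norm_num)]
        norm_num)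
  rw [expect_prodPMF_sum] at h
  exact h

/-- The probability that a Boolean function is true. -/
noncomputable def mass {X : Type*} (μ : PMF X) (g : X → Bool) : ℝ :=
  (μ.toOuterMeasure {x | g x = true}).toReal

theorem toOuterMeasure_le_one {X : Type*} (μ : PMF X) (E : Set X) : μ.toOuterMeasure E ≤ 1 := by
  rw [toOuterMeasure_eq_expect]
  exact expect_le_of_le _ fun _ => ind_le_one _

theorem mass_nonneg {X : Type*} (μ : PMF X) (g : X → Bool) : 0 ≤ mass μ g := ENNReal.toReal_nonneg

theorem mass_le_one {X : Type*} (μ : PMF X) (g : X → Bool) : mass μ g ≤ 1 :=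
  ENNReal.toReal_le_of_le_ofReal zero_le_one (by simpa using toOuterMeasure_le_one μ _)

theorem ofReal_mass {X : Type*} (μ : PMF X) (g : X → Bool) :
    ENNReal.ofReal (mass μ g) = μ.toOuterMeasure {x | g x = true} :=
  ENNReal.ofReal_toReal ((toOuterMeasure_le_one μ _).trans_lt ENNReal.one_lt_top).ne

theorem expect_ind_eq_mass {X : Type*} (μ : PMF X) (g : X → Bool) :
    (expect μ fun x => ind (g x = true)) = ENNReal.ofReal (mass μ g) := by
  rw [ofReal_mass, toOuterMeasure_eq_expect]
  rfl

theorem mass_not {X : Type*} (μ : PMF X) (g : X → Bool) :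
    mass μ (fun x => !g x) = 1 - mass μ g := by
  have h := expect_ind_not μ fun x => g x = true
  have h2 : ∀ x, ind (¬ g x = true) = ind ((!g x) = true) := by
    intro x; cases g x <;> simp
  simp only [h2] at h
  rw [expect_ind_eq_mass, expect_ind_eq_mass μ (fun x => !g x),
    ← ENNReal.ofReal_add (mass_nonneg _ _) (mass_nonneg _ _)] at h
  have := congrArg ENNReal.toReal h
  rw [ENNReal.toReal_ofReal (add_nonneg (mass_nonneg _ _) (mass_nonneg _ _))] at this
  simp at this
  linarith

theorem expect_exp_bval {X : Type*} (μ : PMF X) (g : X → Bool) (l : ℝ) :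
    (expect μ fun x => ENNReal.ofReal (Real.exp (-l * bval (g x)))) =
      ENNReal.ofReal (1 - mass μ g * (1 - Real.exp (-l))) := by
  have h : ∀ x, ENNReal.ofReal (Real.exp (-l * bval (g x))) =
      ind (g x = true) * ENNReal.ofReal (Real.exp (-l)) + ind ((!g x) = true) := by
    intro x; cases h : g x <;> simp [bval, ind]
  simp only [h]
  rw [expect_add, expect_mul_const, expect_ind_eq_mass, expect_ind_eq_mass μ (fun x => !g x),
    mass_not, ← ENNReal.ofReal_mul (mass_nonneg _ _), ← ENNReal.ofReal_add
      (mul_nonneg (mass_nonneg _ _) (Real.exp_pos _).le) (by linarith [mass_le_one μ g])]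
  congr 1
  ring

/-- A lower-tail Chernoff bound. -/
theorem expect_count_lt_le {X ι : Type*} [Fintype ι] (μ : PMF X) (g : X → Bool)
    (hp : 0 < Fintype.card ι * mass μ g) :
    (expect (prodPMF μ ι) fun v => ind (count (fun i => g (v i)) <
      Fintype.card ι * mass μ g - √(2 * (Fintype.card ι * mass μ g)))) ≤ 2⁻¹ := by
  set s : ℕ := Fintype.card ι
  set q := mass μ g
  set p : ℝ := s * q with hpdef
  -- With this tilt the total exponent is `-l √(2p) + l² p / 2 = -2 + 1 = -1`.
  set l : ℝ := √(2 / p) with hl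
  have hl0 : 0 ≤ l := Real.sqrt_nonneg _
  have hl2 : l ^ 2 * p = 2 := by rw [hl, Real.sq_sqrt (by positivity)]; field_simp
  have hls : l * √(2 * p) = 2 := by
    rw [hl, ← Real.sqrt_mul (by positivity)]
    rw [show 2 / p * (2 * p) = 2 ^ 2 by field_simp]
    exact Real.sqrt_sq (by norm_num)
  -- It suffices that `(1 + l + l²/2)(1 - l + l²/2) = 1 + l⁴/4 ≥ 1`.
  have hexp : Real.exp (-l) ≤ 1 - l + l ^ 2 / 2 := by
    have h1 := Real.quadratic_le_exp_of_nonneg hl0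
    have h3 : 0 < 1 - l + l ^ 2 / 2 := by nlinarith [sq_nonneg (l - 1)]
    rw [Real.exp_neg, inv_le_comm₀ (Real.exp_pos _) h3]
    refine le_trans ?_ h1
    rw [inv_le_iff_one_le_mul₀ h3]
    nlinarith [sq_nonneg (l ^ 2)]
  have hpt : ∀ v : ι → X, ind (count (fun i => g (v i)) < p - √(2 * p)) ≤
      ENNReal.ofReal (Real.exp (l * (p - √(2 * p)))) *
        ∏ i, ENNReal.ofReal (Real.exp (-l * bval (g (v i)))) := by
    intro v
    refine ind_le_of fun h => ?_
    rw [← ENNReal.ofReal_prod_of_nonneg (fun _ _ => (Real.exp_pos _).le),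
      ← ENNReal.ofReal_mul (Real.exp_pos _).le, ← Real.exp_sum, ← Real.exp_add, ← Finset.mul_sum,
      ENNReal.one_le_ofReal]
    refine Real.one_le_exp ?_
    have : l * count (fun i => g (v i)) ≤ l * (p - √(2 * p)) := by gcongr
    unfold count at this
    linarith
  refine (expect_mono _ hpt).trans ?_
  rw [expect_const_mul, expect_prodPMF_prod μ fun x => ENNReal.ofReal (Real.exp (-l * bval (g x))),
    expect_exp_bval]
  have hq1 : mass μ g ≤ 1 := mass_le_one μ g
  have hq0 : 0 ≤ mass μ g := mass_nonneg μ g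
  have hnn : 0 ≤ 1 - mass μ g * (1 - Real.exp (-l)) := by
    have : Real.exp (-l) ≤ 1 := by simpa using hl0
    nlinarith [Real.exp_pos (-l)]
  rw [← ENNReal.ofReal_pow hnn, ← ENNReal.ofReal_mul (Real.exp_pos _).le]
  have h2 : (2⁻¹ : ℝ≥0∞) = ENNReal.ofReal (1 / 2) := by
    rw [one_div, ENNReal.ofReal_inv_of_pos (by norm_num)]; norm_num
  rw [h2]
  refine ENNReal.ofReal_le_ofReal ?_
  have h3 : (1 - mass μ g * (1 - Real.exp (-l))) ^ s ≤ Real.exp (-(p * (l - l ^ 2 / 2))) := by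
    calc (1 - mass μ g * (1 - Real.exp (-l))) ^ s
        ≤ Real.exp (-(q * (l - l ^ 2 / 2))) ^ s := by
          refine pow_le_pow_left₀ hnn ?_ _
          have := Real.add_one_le_exp (-(q * (l - l ^ 2 / 2)))
          refine le_trans ?_ this
          have : q * (l - l ^ 2 / 2) ≤ q * (1 - Real.exp (-l)) :=
            mul_le_mul_of_nonneg_left (by linarith) hq0
          simp only [q] at this ⊢
          linarith
      _ = _ := by rw [← Real.exp_nat_mul]; congr 1; rw [hpdef]; ring
  calc Real.exp (l * (p - √(2 * p))) * (1 - mass μ g * (1 - Real.exp (-l))) ^ s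
      ≤ Real.exp (l * (p - √(2 * p))) * Real.exp (-(p * (l - l ^ 2 / 2))) := by gcongr
    _ = Real.exp (-1) := by
        rw [← Real.exp_add]; congr 1
        have : l * (p - √(2 * p)) = l * p - 2 := by rw [mul_sub, hls]
        rw [this]; nlinarith
    _ ≤ 1 / 2 := by
        rw [Real.exp_neg, one_div]
        exact inv_anti₀ (by norm_num) (by linarith [Real.add_one_le_exp (1 : ℝ)])

/-- Relative uniform convergence: `b = p - √(2p)` is a typical count when the mean is `p`. -/
theorem expect_exists_deviation_le {X ι : Type*} [Fintype ι] (μ : PMF X) (G : Set (X → Bool))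
    (N : ℕ) (hN : ∀ w : ι ⊕ ι → X, (patterns G w).card ≤ N) {τ : ℝ} (hτ : 0 ≤ τ) :
    (expect (prodPMF μ ι) fun v => ind (∃ g ∈ G, ∃ b : ℝ,
      b = Fintype.card ι * mass μ g - √(2 * (Fintype.card ι * mass μ g)) ∧
      count (fun i => g (v i)) < b ∧
        τ * (count (fun i => g (v i)) + b) ≤ (b - count (fun i => g (v i))) ^ 2)) ≤
      2 * (N * ENNReal.ofReal (Real.exp (-τ / 2))) := by
  have hpt : ∀ v : ι → X, ind (∃ g ∈ G, ∃ b : ℝ,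
      b = Fintype.card ι * mass μ g - √(2 * (Fintype.card ι * mass μ g)) ∧
      count (fun i => g (v i)) < b ∧
        τ * (count (fun i => g (v i)) + b) ≤ (b - count (fun i => g (v i))) ^ 2) ≤
      2 * expect (prodPMF μ ι) fun v' =>
      ind (∃ g ∈ G, count (fun i => g (v i)) < count (fun i => g (v' i)) ∧
        τ * (count (fun i => g (v i)) + count (fun i => g (v' i))) ≤
          (count (fun i => g (v' i)) - count (fun i => g (v i))) ^ 2) := by
    intro v
    refine ind_le_of ?_
    rintro ⟨g, hg, b, hb, hlt, hdev⟩
    set a := count (fun i => g (v i))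
    have ha : 0 ≤ a := count_nonneg _
    have hp : 0 < Fintype.card ι * mass μ g := by
      have := Real.sqrt_nonneg (2 * (Fintype.card ι * mass μ g))
      linarith
    -- This makes the deviation condition monotone in `b`, so it persists for every ghost count `b'
    -- ≥ b`, which occurs with probability at least one half.
    have hτb : τ ≤ b - a := by
      have : τ * (a + b) ≤ (b - a) * (a + b) := by nlinarith
      exact le_of_mul_le_mul_right this (by linarith)
    have hghost := expect_count_lt_le (ι := ι) μ g hp
    have hsum := expect_ind_not (prodPMF μ ι) fun v' => count (fun i => g (v' i)) < b
    rw [← hb] at hghost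
    have hhalf : (2⁻¹ : ℝ≥0∞) ≤
        expect (prodPMF μ ι) fun v' => ind (¬ count (fun i => g (v' i)) < b) := by
      have h1 : (1 : ℝ≥0∞) ≤
          2⁻¹ + expect (prodPMF μ ι) fun v' => ind (¬ count (fun i => g (v' i)) < b) := by
        rw [← hsum]; gcongr
      rw [← ENNReal.inv_two_add_inv_two] at h1
      exact (ENNReal.add_le_add_iff_left (by norm_num)).1 h1
    calc (1 : ℝ≥0∞) = 2 * 2⁻¹ := (ENNReal.mul_inv_cancel (by norm_num) (by norm_num)).symm
      _ ≤ _ := by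
        gcongr
        refine hhalf.trans (expect_mono _ fun v' => ind_mono fun h => ?_)
        refine ⟨g, hg, ?_, ?_⟩
        · linarith
        · have h' : b ≤ count (fun i => g (v' i)) := not_lt.1 h
          set b' := count (fun i => g (v' i))
          have h3 : τ * (b' - b) ≤ (b - a) * (b' - b) :=
            mul_le_mul_of_nonneg_right hτb (by linarith)
          nlinarith [mul_nonneg (sub_nonneg.2 h') (sub_nonneg.2 hlt.le), sq_nonneg (b' - b)]
  refine (expect_mono _ hpt).trans ?_
  rw [expect_const_mul]
  gcongr
  exact expect_double_sample_le μ G N hN hτ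

/-- Additive uniform convergence. -/
theorem expect_exists_additive_le {X ι : Type*} [Fintype ι] (μ : PMF X) (G : Set (X → Bool))
    (N : ℕ) (hN : ∀ w : ι ⊕ ι → X, (patterns G w).card ≤ N) {α : ℝ} (hα : 0 < α)
    (hs : 8 ≤ α ^ 2 * Fintype.card ι) :
    (expect (prodPMF μ ι) fun v => ind (∃ g ∈ G,
      count (fun i => g (v i)) + α * Fintype.card ι ≤ Fintype.card ι * mass μ g)) ≤
      2 * (N * ENNReal.ofReal (Real.exp (-(α ^ 2 * Fintype.card ι / 16)))) := by
  have h := expect_exists_deviation_le (ι := ι) μ G N hN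
    (τ := α ^ 2 * Fintype.card ι / 8) (by positivity)
  rw [show -(α ^ 2 * Fintype.card ι / 8) / 2 = -(α ^ 2 * Fintype.card ι / 16) by ring] at h
  refine le_trans (expect_mono _ fun v => ind_mono ?_) h
  rintro ⟨g, hg, hdev⟩
  refine ⟨g, hg, _, rfl, ?_⟩
  set s : ℝ := (Fintype.card ι : ℝ)
  set a := count (fun i => g (v i))
  have ha : 0 ≤ a := count_nonneg _
  have hs0 : 0 < s := by
    by_contra hneg
    have : s = 0 := le_antisymm (not_lt.1 hneg) (Nat.cast_nonneg _)
    rw [this] at hs; norm_num at hs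
  have hp0 : 0 ≤ s * mass μ g := mul_nonneg hs0.le (mass_nonneg _ _)
  have hps : s * mass μ g ≤ s := by nlinarith [mass_le_one μ g]
  set p := s * mass μ g
  -- The ghost correction uses at most half of the deviation `α s`; this is where `8 ≤ α² s` enters.
  have hsq : √(2 * p) ≤ α * s / 2 := by
    rw [Real.sqrt_le_left (by positivity)]
    nlinarith
  have hsq0 := Real.sqrt_nonneg (2 * p)
  have h1 : α * s / 2 ≤ p - √(2 * p) - a := by linarith
  have h2 : 0 < α * s / 2 := by positivity
  refine ⟨by linarith, ?_⟩
  calc α ^ 2 * s / 8 * (a + (p - √(2 * p))) ≤ α ^ 2 * s / 8 * (2 * s) := by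
        gcongr; linarith
    _ = (α * s / 2) ^ 2 := by ring
    _ ≤ _ := by gcongr

/-- Multiplicative uniform convergence. -/
theorem expect_exists_multiplicative_le {X ι : Type*} [Fintype ι] (μ : PMF X) (G : Set (X → Bool))
    (N : ℕ) (hN : ∀ w : ι ⊕ ι → X, (patterns G w).card ≤ N) {p₀ : ℝ} (hp₀ : 8 ≤ p₀) :
    (expect (prodPMF μ ι) fun v => ind (∃ g ∈ G, p₀ ≤ Fintype.card ι * mass μ g ∧
      8 * count (fun i => g (v i)) ≤ Fintype.card ι * mass μ g)) ≤
      2 * (N * ENNReal.ofReal (Real.exp (-(p₀ / 10)))) := by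
  have h := expect_exists_deviation_le (ι := ι) μ G N hN (τ := p₀ / 5) (by positivity)
  rw [show -(p₀ / 5) / 2 = -(p₀ / 10) by ring] at h
  refine le_trans (expect_mono _ fun v => ind_mono ?_) h
  rintro ⟨g, hg, hp, hdev⟩
  refine ⟨g, hg, _, rfl, ?_⟩
  set p : ℝ := (Fintype.card ι : ℝ) * mass μ g
  set a := count (fun i => g (v i))
  have ha : 0 ≤ a := count_nonneg _
  have hsq : √(2 * p) ≤ p / 2 := by
    rw [Real.sqrt_le_left (by linarith)]
    nlinarith
  set b := p - √(2 * p)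
  have hb : p / 2 ≤ b := by simp only [b]; linarith
  refine ⟨by linarith, ?_⟩
  have h1 : p₀ / 5 * (a + b) ≤ p / 5 * (a + b) := by
    gcongr; linarith
  -- From `a ≤ p/8 ≤ b/4` and `p ≤ 2b`, the left side is at most `b²/2` and the right side at least
  -- `9b²/16`.
  have h2 : 0 ≤ (b - 4 * a) := by linarith
  nlinarith [mul_nonneg (sub_nonneg.2 hb) (by linarith : (0:ℝ) ≤ a + b)]

/-! ### Disagreement classes and errors. -/

/-- The disagreement functions of the members of `F` with `c`. -/
def xorWith {X : Type*} (F : Set (X → Bool)) (c : X → Bool) : Set (X → Bool) :=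
  {g | ∃ f ∈ F, g = fun x => f x ^^ c x}

/-- The pairwise disagreement functions of the members of `F`. -/
def xorPairs {X : Type*} (F : Set (X → Bool)) : Set (X → Bool) :=
  {g | ∃ f ∈ F, ∃ f' ∈ F, g = fun x => f x ^^ f' x}

theorem card_patterns_xorWith_le {X κ : Type*} [Fintype κ] (F : Set (X → Bool)) (c : X → Bool)
    (w : κ → X) : (patterns (xorWith F c) w).card ≤ (patterns F w).card := by
  classical
  refine (Finset.card_le_card ?_).trans
    (Finset.card_image_le (s := patterns F w) (f := fun π k => π k ^^ c (w k)))
  intro π hπ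
  obtain ⟨_, ⟨f, hf, rfl⟩, h⟩ := mem_patterns.1 hπ
  exact Finset.mem_image.2 ⟨fun k => f (w k), mem_patterns.2 ⟨f, hf, fun _ => rfl⟩, funext h⟩

theorem card_patterns_xorPairs_le {X κ : Type*} [Fintype κ] (F : Set (X → Bool))
    (w : κ → X) : (patterns (xorPairs F) w).card ≤ (patterns F w).card ^ 2 := by
  classical
  rw [sq, ← Finset.card_product]
  refine (Finset.card_le_card ?_).trans
    (Finset.card_image_le (s := patterns F w ×ˢ patterns F w) (f := fun q k => q.1 k ^^ q.2 k))
  intro π hπ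
  obtain ⟨_, ⟨f, hf, f', hf', rfl⟩, h⟩ := mem_patterns.1 hπ
  exact Finset.mem_image.2 ⟨(fun k => f (w k), fun k => f' (w k)),
    Finset.mem_product.2 ⟨mem_patterns.2 ⟨f, hf, fun _ => rfl⟩,
      mem_patterns.2 ⟨f', hf', fun _ => rfl⟩⟩, funext h⟩

/-- The real value of the generalization error. -/
noncomputable def err {X : Type*} (μ : PMF X) (c h : X → Bool) : ℝ := mass μ fun x => h x ^^ c x

theorem genError_eq {X : Type*} (μ : PMF X) (c h : X → Bool) :
    genError μ c h = ENNReal.ofReal (err μ c h) := by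
  rw [err, ofReal_mass, genError]
  simp

theorem err_nonneg {X : Type*} (μ : PMF X) (c h : X → Bool) : 0 ≤ err μ c h := mass_nonneg _ _

theorem err_triangle {X : Type*} (μ : PMF X) (c f h : X → Bool) :
    err μ c h ≤ err μ f h + err μ c f := by
  rw [← ENNReal.ofReal_le_ofReal_iff (add_nonneg (err_nonneg _ _ _) (err_nonneg _ _ _)),
    ENNReal.ofReal_add (err_nonneg _ _ _) (err_nonneg _ _ _)]
  simp only [err, ← expect_ind_eq_mass]
  rw [← expect_add]
  refine expect_mono _ fun x => ind_le_add ?_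
  cases h x <;> cases c x <;> cases f x <;> simp

/-- The number of labeled examples on which `f` errs. -/
def disagreements {X σ : Type*} [Fintype σ] (S : σ → X × Bool) (f : X → Bool) : ℕ :=
  (Finset.univ.filter fun i => f (S i).1 ≠ (S i).2).card

theorem disagreements_eq_count {X σ : Type*} [Fintype σ] (S : σ → X × Bool) (f : X → Bool) :
    (disagreements S f : ℝ) = count fun i => f (S i).1 ^^ (S i).2 := by
  rw [disagreements, Finset.card_filter, count]
  push_cast
  refine Finset.sum_congr rfl fun i _ => ?_
  cases f (S i).1 <;> cases (S i).2 <;> simp [bval]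

theorem disagreements_le_succ {X σ : Type*} [Fintype σ] {S S' : σ → X × Bool} (i : σ)
    (h : ∀ j, j ≠ i → S j = S' j) (f : X → Bool) :
    disagreements S f ≤ disagreements S' f + 1 := by
  classical
  unfold disagreements
  rw [← Finset.card_singleton i]
  refine (Finset.card_le_card ?_).trans (Finset.card_union_le _ _)
  intro j hj
  by_cases hji : j = i
  · simp [hji]
  · refine Finset.mem_union_left _ ?_
    simpa [h j hji] using hj

/-! ### The exponential mechanism on labelings. -/

/-- The weight of a labeling `p` of the points `T`: it decays exponentially in the least number of
errors on `S` of a member of `F` that extends `p`. -/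
noncomputable def relabelWeight {X σ τ : Type*} [Fintype σ] (F : Set (X → Bool))
    (S : σ → X × Bool) (T : τ → X) (p : τ → Bool) : ℝ≥0∞ :=
  ⨆ f ∈ F, ⨆ _ : ∀ k, f (T k) = p k, (2⁻¹ : ℝ≥0∞) ^ disagreements S f

theorem le_relabelWeight {X σ τ : Type*} [Fintype σ] {F : Set (X → Bool)} (S : σ → X × Bool)
    {T : τ → X} {p : τ → Bool} {f : X → Bool} (hf : f ∈ F) (hp : ∀ k, f (T k) = p k) :
    (2⁻¹ : ℝ≥0∞) ^ disagreements S f ≤ relabelWeight F S T p := by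
  refine le_trans ?_ (le_iSup₂ (f := fun f (_ : f ∈ F) =>
    ⨆ _ : ∀ k, f (T k) = p k, (2⁻¹ : ℝ≥0∞) ^ disagreements S f) f hf)
  exact le_iSup (fun _ : ∀ k, f (T k) = p k => (2⁻¹ : ℝ≥0∞) ^ disagreements S f) hp

theorem relabelWeight_le {X σ τ : Type*} [Fintype σ] {F : Set (X → Bool)} {S : σ → X × Bool}
    {T : τ → X} {p : τ → Bool} {c : ℝ≥0∞}
    (h : ∀ f ∈ F, (∀ k, f (T k) = p k) → (2⁻¹ : ℝ≥0∞) ^ disagreements S f ≤ c) :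
    relabelWeight F S T p ≤ c :=
  iSup₂_le fun f hf => iSup_le fun hp => h f hf hp

theorem relabelWeight_le_one {X σ τ : Type*} [Fintype σ] (F : Set (X → Bool)) (S : σ → X × Bool)
    (T : τ → X) (p : τ → Bool) : relabelWeight F S T p ≤ 1 :=
  relabelWeight_le fun _ _ _ => pow_le_one₀ zero_le (by norm_num)

theorem relabelWeight_sum_ne_zero {X σ τ : Type*} [Fintype σ] {F : Set (X → Bool)}
    (hF : F.Nonempty) (S : σ → X × Bool) (T : τ → X) : ∑' p, relabelWeight F S T p ≠ 0 := by
  obtain ⟨f, hf⟩ := hF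
  refine ne_of_gt (lt_of_lt_of_le ?_ (ENNReal.le_tsum fun k => f (T k)))
  refine lt_of_lt_of_le ?_ (le_relabelWeight S hf fun _ => rfl)
  exact ENNReal.pow_pos (by norm_num) _

theorem relabelWeight_sum_ne_top {X σ τ : Type*} [Fintype σ] [Fintype τ] (F : Set (X → Bool))
    (S : σ → X × Bool) (T : τ → X) : ∑' p, relabelWeight F S T p ≠ ∞ := by
  classical
  rw [tsum_fintype]
  exact ENNReal.sum_ne_top.2 fun p _ =>
    ((relabelWeight_le_one F S T p).trans_lt ENNReal.one_lt_top).ne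

/-- The exponential mechanism that chooses a labeling of the points `T` by a member of `F`,
preferring those that agree with the labeled examples `S`. -/
noncomputable def relabel {X σ τ : Type*} [Fintype σ] [Fintype τ] {F : Set (X → Bool)}
    (hF : F.Nonempty) (S : σ → X × Bool) (T : τ → X) : PMF (τ → Bool) :=
  PMF.normalize (relabelWeight F S T) (relabelWeight_sum_ne_zero hF S T)
    (relabelWeight_sum_ne_top F S T)

theorem expect_relabel {X σ τ : Type*} [Fintype σ] [Fintype τ] {F : Set (X → Bool)}
    (hF : F.Nonempty) (S : σ → X × Bool) (T : τ → X) (v : (τ → Bool) → ℝ≥0∞) :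
    expect (relabel hF S T) v =
      (∑' p, relabelWeight F S T p * v p) / ∑' p, relabelWeight F S T p := by
  simp only [expect, relabel, PMF.normalize_apply]
  rw [div_eq_mul_inv, ← ENNReal.tsum_mul_right]
  exact tsum_congr fun p => by ring

/-- The two factors of the exponential mechanism: 2 from the unnormalized weights and 2 from the
normalizer. -/
theorem div_le_four_mul_div {N N' Z Z' : ℝ≥0∞} (hN : N ≤ 2 * N') (hZ : Z' ≤ 2 * Z) :
    N / Z ≤ 4 * (N' / Z') := by
  have hZ' : Z⁻¹ ≤ 2 * Z'⁻¹ := by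
    rw [ENNReal.inv_le_iff_inv_le, ENNReal.mul_inv (by simp) (by simp), inv_inv]
    calc 2⁻¹ * Z' ≤ 2⁻¹ * (2 * Z) := by gcongr
      _ = Z := by rw [← mul_assoc, ENNReal.inv_mul_cancel (by norm_num) (by norm_num), one_mul]
  calc N / Z ≤ (2 * N') * (2 * Z'⁻¹) := by rw [div_eq_mul_inv]; gcongr
    _ = 4 * (N' / Z') := by rw [div_eq_mul_inv]; ring

theorem relabelWeight_le_two_mul {X σ τ : Type*} [Fintype σ] {F : Set (X → Bool)}
    {S S' : σ → X × Bool} (i : σ) (h : ∀ j, j ≠ i → S j = S' j) (T : τ → X) (p : τ → Bool) :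
    relabelWeight F S T p ≤ 2 * relabelWeight F S' T p := by
  refine relabelWeight_le fun f hf hp => ?_
  have h1 := le_relabelWeight S' hf hp
  have h2 := disagreements_le_succ i (fun j hj => (h j hj).symm) f
  calc (2⁻¹ : ℝ≥0∞) ^ disagreements S f
      = 2 * 2⁻¹ ^ (disagreements S f + 1) := by
        rw [pow_succ', ← mul_assoc, ENNReal.mul_inv_cancel (by norm_num) (by norm_num), one_mul]
    _ ≤ 2 * 2⁻¹ ^ disagreements S' f := by
        exact mul_le_mul_right (pow_le_pow_of_le_one zero_le (by norm_num) h2) _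
    _ ≤ _ := by gcongr

theorem expect_relabel_le_of_labeled {X σ τ : Type*} [Fintype σ] [Fintype τ]
    {F : Set (X → Bool)} (hF : F.Nonempty) {S S' : σ → X × Bool} (i : σ)
    (h : ∀ j, j ≠ i → S j = S' j) (T : τ → X) (v : (τ → Bool) → ℝ≥0∞) :
    expect (relabel hF S T) v ≤ 4 * expect (relabel hF S' T) v := by
  rw [expect_relabel, expect_relabel]
  refine div_le_four_mul_div ?_ ?_
  · rw [← ENNReal.tsum_mul_left]
    refine ENNReal.tsum_le_tsum fun p => ?_
    rw [← mul_assoc]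
    exact mul_le_mul_left (relabelWeight_le_two_mul i h T p) _
  · rw [← ENNReal.tsum_mul_left]
    exact ENNReal.tsum_le_tsum fun p =>
      relabelWeight_le_two_mul i (fun j hj => (h j hj).symm) T p

/-- Negating the label at one index. -/
def flipAt {τ : Type*} [DecidableEq τ] (i : τ) : (τ → Bool) ≃ (τ → Bool) where
  toFun p := Function.update p i (!p i)
  invFun p := Function.update p i (!p i)
  left_inv p := by simp
  right_inv p := by simp

theorem flipAt_of_ne {τ : Type*} [DecidableEq τ] {i j : τ} (h : j ≠ i) (p : τ → Bool) :
    flipAt i p j = p j := by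
  simp [flipAt, h]

theorem flipAt_flipAt {τ : Type*} [DecidableEq τ] (i : τ) (p : τ → Bool) :
    flipAt i (flipAt i p) = p := (flipAt i).left_inv p

/-- Moving the point `T i` leaves each `f` and its number of errors on `S` unchanged, but may alter
the label that `f` gives in slot `i`. So the weight of a labeling is shared between the two
labelings that agree off `i`. -/
theorem relabelWeight_le_add_flipAt {X σ τ : Type*} [Fintype σ] [DecidableEq τ]
    {F : Set (X → Bool)} (S : σ → X × Bool) {T T' : τ → X} (i : τ)
    (h : ∀ j, j ≠ i → T j = T' j) (p : τ → Bool) :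
    relabelWeight F S T p ≤ relabelWeight F S T' p + relabelWeight F S T' (flipAt i p) := by
  refine relabelWeight_le fun f hf hp => ?_
  by_cases hi : f (T' i) = p i
  · refine (le_relabelWeight S hf fun k => ?_).trans le_self_add
    by_cases hk : k = i
    · rw [hk, hi]
    · rw [← h k hk, hp]
  · refine (le_relabelWeight S hf fun k => ?_).trans le_add_self
    by_cases hk : k = i
    · rw [hk]
      simp only [flipAt, Equiv.coe_fn_mk, Function.update_self]
      revert hi
      cases f (T' i) <;> cases p i <;> simp
    · rw [flipAt_of_ne hk, ← h k hk, hp]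

/-- Each labeling on the old points is charged to two labelings on the new ones. The assumption on
`v` and `v'` absorbs the possible change of label in slot `i`, so privacy of the mechanism and of
its consumer are combined in one estimate. -/
theorem expect_relabel_le_of_unlabeled {X σ τ : Type*} [Fintype σ] [Fintype τ]
    {F : Set (X → Bool)} (hF : F.Nonempty) (S : σ → X × Bool) {T T' : τ → X} (i : τ)
    (h : ∀ j, j ≠ i → T j = T' j) {v v' : (τ → Bool) → ℝ≥0∞} {C δ : ℝ≥0∞}
    (hv : ∀ p p' : τ → Bool, (∀ j, j ≠ i → p j = p' j) → v p ≤ C * v' p' + δ) :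
    expect (relabel hF S T) v ≤ 4 * (C * expect (relabel hF S T') v' + δ) := by
  classical
  have key : expect (relabel hF S T) v ≤
      4 * expect (relabel hF S T') fun p => C * v' p + δ := by
    rw [expect_relabel, expect_relabel]
    refine div_le_four_mul_div ?_ ?_
    · calc (∑' p, relabelWeight F S T p * v p)
          ≤ ∑' p, (relabelWeight F S T' p * v p +
              relabelWeight F S T' (flipAt i p) * v p) := by
            refine ENNReal.tsum_le_tsum fun p => ?_
            rw [← add_mul]
            exact mul_le_mul_left (relabelWeight_le_add_flipAt S i h p) _
        _ = ∑' p, (relabelWeight F S T' p * v p +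
              relabelWeight F S T' p * v (flipAt i p)) := by
            rw [ENNReal.tsum_add, ENNReal.tsum_add]
            congr 1
            rw [← (flipAt i).tsum_eq]
            exact tsum_congr fun p => by rw [flipAt_flipAt]
        _ ≤ ∑' p, 2 * (relabelWeight F S T' p * (C * v' p + δ)) := by
            refine ENNReal.tsum_le_tsum fun p => ?_
            rw [two_mul]
            gcongr
            · exact hv _ _ fun _ _ => rfl
            · exact hv _ _ fun j hj => flipAt_of_ne hj p
        _ = _ := ENNReal.tsum_mul_left
    · calc (∑' p, relabelWeight F S T' p)
          ≤ ∑' p, (relabelWeight F S T p + relabelWeight F S T (flipAt i p)) :=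
            ENNReal.tsum_le_tsum fun p =>
              relabelWeight_le_add_flipAt S i (fun j hj => (h j hj).symm) p
        _ = _ := by
            rw [ENNReal.tsum_add, (flipAt i).tsum_eq (relabelWeight F S T), two_mul]
  rwa [expect_add, expect_const_mul, expect_const] at key

/-- The chosen labeling extends to a member of `F` that is nearly optimal on `S`. -/
theorem expect_relabel_suboptimal_le {X σ τ : Type*} [Fintype σ] [Fintype τ]
    {F : Set (X → Bool)} (hF : F.Nonempty) (S : σ → X × Bool) (T : τ → X) (k : ℕ) :
    (expect (relabel hF S T) fun p => ind (¬ ∃ f ∈ F, (∀ j, f (T j) = p j) ∧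
      ∀ f₀ ∈ F, disagreements S f < disagreements S f₀ + k)) ≤
      (patterns F T).card * 2⁻¹ ^ k := by
  classical
  obtain ⟨f₀, hf₀, hmin⟩ : ∃ f₀ ∈ F, ∀ f ∈ F, disagreements S f₀ ≤ disagreements S f := by
    obtain ⟨f₀, hf₀, hm⟩ := WellFounded.has_min (InvImage.wf (disagreements S) Nat.lt_wfRel.wf) F hF
    exact ⟨f₀, hf₀, fun f hf => not_lt.1 (hm f hf)⟩
  rw [expect_relabel]
  have hpow0 : (2⁻¹ : ℝ≥0∞) ^ disagreements S f₀ ≠ 0 := (ENNReal.pow_pos (by norm_num) _).ne'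
  have hpowt : (2⁻¹ : ℝ≥0∞) ^ disagreements S f₀ ≠ ∞ := ENNReal.pow_ne_top (by norm_num)
  have hZ : (2⁻¹ : ℝ≥0∞) ^ disagreements S f₀ ≤ ∑' p, relabelWeight F S T p :=
    (le_relabelWeight S hf₀ fun _ => rfl).trans (ENNReal.le_tsum fun k => f₀ (T k))
  have hnum : (∑' p, relabelWeight F S T p * ind (¬ ∃ f ∈ F, (∀ j, f (T j) = p j) ∧
      ∀ f₀ ∈ F, disagreements S f < disagreements S f₀ + k)) ≤
      (patterns F T).card * 2⁻¹ ^ (disagreements S f₀ + k) := by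
    rw [tsum_eq_sum (s := patterns F T)]
    · rw [← nsmul_eq_mul]
      refine Finset.sum_le_card_nsmul _ _ _ fun p _ => ?_
      by_cases hbad : ∃ f ∈ F, (∀ j, f (T j) = p j) ∧
          ∀ f₀ ∈ F, disagreements S f < disagreements S f₀ + k
      · rw [ind_false (not_not.2 hbad), mul_zero]; exact zero_le
      · rw [ind_true hbad, mul_one]
        refine relabelWeight_le fun f hf hp => ?_
        refine pow_le_pow_of_le_one zero_le (by norm_num) ?_
        by_contra hlt
        refine hbad ⟨f, hf, hp, fun f₁ hf₁ => ?_⟩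
        -- An `f` with fewer than `k` errors above the minimum would make the labeling good; so
        -- every extension of a bad labeling has weight at most `2^-k` times the optimal one.
        have := hmin f₁ hf₁
        omega
    · intro p hp
      have : relabelWeight F S T p = 0 := by
        refine le_antisymm (relabelWeight_le fun f hf hfp => ?_) zero_le
        exact absurd (mem_patterns.2 ⟨f, hf, hfp⟩) hp
      rw [this, zero_mul]
  refine (ENNReal.div_le_div hnum hZ).trans (le_of_eq ?_)
  rw [pow_add, div_eq_mul_inv]
  calc ((patterns F T).card : ℝ≥0∞) * (2⁻¹ ^ disagreements S f₀ * 2⁻¹ ^ k) *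
        (2⁻¹ ^ disagreements S f₀)⁻¹
      = (patterns F T).card * 2⁻¹ ^ k *
        (2⁻¹ ^ disagreements S f₀ * (2⁻¹ ^ disagreements S f₀)⁻¹) := by ring
    _ = _ := by rw [ENNReal.mul_inv_cancel hpow0 hpowt, mul_one]

/-! ### Robust learners and the relabeling step. -/

theorem toOuterMeasure_mono' {α : Type*} (p : PMF α) {E E' : Set α} (h : E ⊆ E') :
    p.toOuterMeasure E ≤ p.toOuterMeasure E' := by
  rw [toOuterMeasure_eq_expect, toOuterMeasure_eq_expect]
  exact expect_mono _ fun a => ind_mono fun ha => h ha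

/-- A learner on labeled examples indexed by `σ` and unlabeled ones indexed by `ρ` such that
changing a labeled (unlabeled) example costs a factor `8` (`32`), whose outputs lie in `H`, and
which learns `F` even if the target is chosen depending on the labeled points. -/
structure IsRobustLearner {X σ ρ : Type*} [Fintype σ] [Fintype ρ] (F H : Set (X → Bool))
    (a : ℝ) (b D : ℝ≥0∞) (alg : (σ → X × Bool) → (ρ → X) → PMF (X → Bool)) : Prop where
  labeled : ∀ (i : σ) (S S' : σ → X × Bool), (∀ j, j ≠ i → S j = S' j) → ∀ R E,
    (alg S R).toOuterMeasure E ≤ 8 * (alg S' R).toOuterMeasure E + 8 * D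
  unlabeled : ∀ (S : σ → X × Bool) (i : ρ) (R R' : ρ → X), (∀ j, j ≠ i → R j = R' j) → ∀ E,
    (alg S R).toOuterMeasure E ≤ 32 * (alg S R').toOuterMeasure E + 32 * D
  outputs : ∀ S R, (alg S R).support ⊆ H
  accurate : ∀ μ : PMF X, (expect (prodPMF μ σ) fun x => ⨆ f ∈ F, expect (prodPMF μ ρ) fun y =>
    (alg (fun i => (x i, f (x i))) y).toOuterMeasure {h | a < err μ f h}) ≤ b

/-- Relabel the first block of unlabeled points, then run the given algorithm on it. -/
noncomputable def relabelThen {X σ τ ρ : Type*} [Fintype σ] [Fintype τ] {F : Set (X → Bool)}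
    (hF : F.Nonempty) (alg : (τ → X × Bool) → (ρ → X) → PMF (X → Bool))
    (S : σ → X × Bool) (W : τ ⊕ ρ → X) : PMF (X → Bool) :=
  (relabel hF S fun k => W (Sum.inl k)).bind fun p =>
    alg (fun k => (W (Sum.inl k), p k)) fun k => W (Sum.inr k)

/-- The labeled examples influence only the mechanism and `alg` is post-processing, so no privacy of
`alg` is needed. This is what stops the loss from accumulating over the levels. -/
theorem relabelThen_labeled {X σ τ ρ : Type*} [Fintype σ] [Fintype τ] {F : Set (X → Bool)}
    (hF : F.Nonempty) (alg : (τ → X × Bool) → (ρ → X) → PMF (X → Bool)) (D : ℝ≥0∞)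
    (i : σ) (S S' : σ → X × Bool) (h : ∀ j, j ≠ i → S j = S' j)
    (W : τ ⊕ ρ → X) (E : Set (X → Bool)) :
    (relabelThen hF alg S W).toOuterMeasure E ≤
      8 * (relabelThen hF alg S' W).toOuterMeasure E + 8 * D := by
  simp only [relabelThen, toOuterMeasure_bind_eq]
  refine (expect_relabel_le_of_labeled hF i h _ _).trans (le_trans ?_ le_self_add)
  gcongr
  norm_num

section relabelThen

variable {X σ τ ρ : Type*} [Fintype σ] [Fintype τ] [Fintype ρ] {F H : Set (X → Bool)}
  (hF : F.Nonempty) {a : ℝ} {b D : ℝ≥0∞} {alg : (τ → X × Bool) → (ρ → X) → PMF (X → Bool)}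
-- A point of the relabeled block costs `4 * 8`, namely the mechanism and one labeled entry of
-- `alg`; the remaining points pass directly to `alg` and inherit its factor 32.
theorem relabelThen_unlabeled (halg : IsRobustLearner F H a b D alg)
    (S : σ → X × Bool) (i : τ ⊕ ρ) (W W' : τ ⊕ ρ → X)
    (h : ∀ j, j ≠ i → W j = W' j) (E : Set (X → Bool)) :
    (relabelThen hF alg S W).toOuterMeasure E ≤
      32 * (relabelThen hF alg S W').toOuterMeasure E + 32 * D := by
  simp only [relabelThen, toOuterMeasure_bind_eq]
  rcases i with i | i
  · have hr : (fun k => W (Sum.inr k)) = fun k => W' (Sum.inr k) :=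
      funext fun k => h _ (by simp)
    rw [hr]
    refine (expect_relabel_le_of_unlabeled hF S (T' := fun k => W' (Sum.inl k)) i
      (fun j hj => h _ (by simpa using hj)) (C := 8) (δ := 8 * D)
      (v' := fun p => (alg (fun k => (W' (Sum.inl k), p k))
        fun k => W' (Sum.inr k)).toOuterMeasure E) ?_).trans (le_of_eq ?_)
    · intro p p' hp
      refine halg.labeled i _ _ (fun j hj => ?_) _ _
      rw [hp j hj, h (Sum.inl j) (by simpa using hj)]
    · ring
  · have hl : (fun k => W (Sum.inl k)) = fun k => W' (Sum.inl k) :=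
      funext fun k => h _ (by simp)
    have hl' : ∀ k, W (Sum.inl k) = W' (Sum.inl k) := fun k => congrFun hl k
    simp only [hl']
    refine (expect_mono _ fun p => halg.unlabeled _ i _ (fun k => W' (Sum.inr k))
      (fun j hj => h _ (by simpa using hj)) E).trans ?_
    rw [expect_add, expect_const_mul, expect_const]

theorem relabelThen_outputs (halg : IsRobustLearner F H a b D alg)
    (S : σ → X × Bool) (W : τ ⊕ ρ → X) :
    (relabelThen hF alg S W).support ⊆ H := by
  rw [relabelThen, PMF.support_bind]
  exact Set.iUnion₂_subset fun p _ => halg.outputs _ _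

/-- Outside an event of probability `N * 2⁻¹ ^ k` the chosen labels come from a near-optimal `f ∈
F`. This `f` depends on the relabeled points, which is covered by the supremum inside the
expectation in `accurate`. -/
theorem expect_relabelThen_le (halg : IsRobustLearner F H a b D alg)
    (μ : PMF X) (S : σ → X × Bool) (k N : ℕ)
    (hN : ∀ w : τ → X, (patterns F w).card ≤ N) (Bad : Set (X → Bool))
    (hBad : ∀ f ∈ F, (∀ f₀ ∈ F, disagreements S f < disagreements S f₀ + k) →
      ∀ h ∈ Bad, a < err μ f h) :
    (expect (prodPMF μ (τ ⊕ ρ)) fun W => (relabelThen hF alg S W).toOuterMeasure Bad) ≤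
      N * 2⁻¹ ^ k + b := by
  rw [expect_prodPMF_sum]
  let B : (τ → X) → (τ → Bool) → Prop := fun t p => ¬ ∃ f ∈ F, (∀ j, f (t j) = p j) ∧
      ∀ f₀ ∈ F, disagreements S f < disagreements S f₀ + k
  have hpt : ∀ (t : τ → X) (p : τ → Bool), (expect (prodPMF μ ρ) fun r =>
      (alg (fun k => (t k, p k)) r).toOuterMeasure Bad) ≤ ind (B t p) +
      ⨆ f ∈ F, expect (prodPMF μ ρ) fun y =>
        (alg (fun i => (t i, f (t i))) y).toOuterMeasure {h | a < err μ f h} := by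
    intro t p
    by_cases hB : B t p
    · rw [ind_true hB]
      exact (expect_le_of_le _ fun r => toOuterMeasure_le_one _ _).trans le_self_add
    · obtain ⟨f, hf, hfp, hopt⟩ := not_not.1 hB
      refine le_trans ?_ (le_add_self.trans (add_le_add_right (le_iSup₂ (f := fun f (_ : f ∈ F) =>
        expect (prodPMF μ ρ) fun y =>
        (alg (fun i => (t i, f (t i))) y).toOuterMeasure {h | a < err μ f h}) f hf) _))
      simp only [hfp]
      exact expect_mono _ fun r => toOuterMeasure_mono' _ (hBad f hf hopt)
  have ht : ∀ t : τ → X, (expect (prodPMF μ ρ) fun r =>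
      (relabelThen hF alg S (Sum.elim t r)).toOuterMeasure Bad) ≤ N * 2⁻¹ ^ k +
      ⨆ f ∈ F, expect (prodPMF μ ρ) fun y =>
        (alg (fun i => (t i, f (t i))) y).toOuterMeasure {h | a < err μ f h} := by
    intro t
    simp only [relabelThen, Sum.elim_inl, Sum.elim_inr, toOuterMeasure_bind_eq]
    -- The mechanism does not see `r`, so `r` may be drawn after the labeling.
    rw [expect_comm]
    refine (expect_mono _ (hpt t)).trans ?_
    rw [expect_add, expect_const]
    gcongr
    refine (expect_relabel_suboptimal_le hF S t k).trans ?_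
    gcongr
    exact hN t
  refine (expect_mono _ ht).trans ?_
  rw [expect_add, expect_const]
  gcongr
  exact halg.accurate μ

/-- The target itself makes no error on the sample, so the chosen `f'` has at most `k ≤ p₀/8`
disagreements with it. Multiplicative convergence over all pairs in `F` gives error below `p₀ /
|σ|`; uniformity in both members of the pair preserves the supremum over targets. -/
theorem IsRobustLearner.relabelThen (halg : IsRobustLearner F H a b D alg)
    {d k : ℕ} (hd : vcDim F ≤ d) (hσ : 0 < Fintype.card σ)
    (hτ : Fintype.card τ = 2 * Fintype.card σ) {p₀ a₁ : ℝ} (hp₀ : 8 ≤ p₀) (hk : 8 * (k : ℝ) ≤ p₀)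
    (ha₁ : p₀ ≤ a₁ * Fintype.card σ) {b₁ : ℝ≥0∞}
    (hb₁ : 2 * (((growth d (2 * Fintype.card σ) ^ 2 : ℕ) : ℝ≥0∞) *
      ENNReal.ofReal (Real.exp (-(p₀ / 10)))) ≤ b₁)
    (hb₂ : (growth d (2 * Fintype.card σ) : ℝ≥0∞) * 2⁻¹ ^ k ≤ b₁) :
    IsRobustLearner F H (a + a₁) (b + 2 * b₁) D
      (relabelThen hF alg : (σ → X × Bool) → (τ ⊕ ρ → X) → PMF (X → Bool)) where
  labeled := relabelThen_labeled hF alg D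
  unlabeled := relabelThen_unlabeled hF halg
  outputs := relabelThen_outputs hF halg
  accurate μ := by
    let G : (σ → X) → Prop := fun x => ∃ g ∈ xorPairs F, p₀ ≤ Fintype.card σ * mass μ g ∧
      8 * count (fun i => g (x i)) ≤ Fintype.card σ * mass μ g
    have hG : (expect (prodPMF μ σ) fun x => ind (G x)) ≤ b₁ := by
      refine (expect_exists_multiplicative_le μ (xorPairs F) _ (fun w => ?_) hp₀).trans hb₁
      refine (card_patterns_xorPairs_le F w).trans (Nat.pow_le_pow_left ?_ 2)
      refine (card_patterns_le hd w).trans (le_of_eq ?_)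
      rw [Fintype.card_sum, two_mul]
    have hx : ∀ x : σ → X, (⨆ f ∈ F, expect (prodPMF μ (τ ⊕ ρ)) fun W =>
        (PrivateLearning.relabelThen hF alg (fun i => (x i, f (x i))) W).toOuterMeasure
          {h | a + a₁ < err μ f h}) ≤
        ind (G x) + (b₁ + b) := by
      intro x
      refine iSup₂_le fun f hf => ?_
      by_cases hGx : G x
      · rw [ind_true hGx]
        exact (expect_le_of_le _ fun r => toOuterMeasure_le_one _ _).trans le_self_add
      refine le_trans ?_ le_add_self
      refine (expect_relabelThen_le hF halg μ _ k (growth d (2 * Fintype.card σ)) ?_ _ ?_).trans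
        (add_le_add_left hb₂ b)
      · intro w
        rw [← hτ]
        exact card_patterns_le hd w
      · intro f' hf' hopt h hh
        have h0 : disagreements (fun i => (x i, f (x i))) f = 0 := by simp [disagreements]
        have h1 := hopt f hf
        rw [h0, zero_add] at h1
        have h2 : (disagreements (fun i => (x i, f (x i))) f' : ℝ) ≤ k := by exact_mod_cast h1.le
        rw [disagreements_eq_count] at h2
        have h3 : Fintype.card σ * err μ f f' < p₀ := by
          by_contra hcon
          exact hGx ⟨_, ⟨f', hf', f, hf, rfl⟩, not_lt.1 hcon, by
            have := not_lt.1 hcon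
            unfold err at this
            linarith⟩
        have hs : (0 : ℝ) < Fintype.card σ := by exact_mod_cast hσ
        have h4 : err μ f f' < a₁ := by
          refine lt_of_mul_lt_mul_left (h3.trans_le ?_) hs.le
          rwa [mul_comm]
        have h5 : a + a₁ < err μ f h := hh
        have := err_triangle μ f f' h
        linarith
    refine (expect_mono _ hx).trans ?_
    rw [expect_add, expect_const, two_mul, add_comm b]
    calc _ ≤ b₁ + (b₁ + b) := by gcongr
      _ = _ := by ring

/-- On labeled examples of an arbitrary concept `c`, the algorithm competes with `F`. -/
theorem expect_relabelThen_agnostic_le (halg : IsRobustLearner F H a b D alg)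
    {d k : ℕ} (hd : vcDim F ≤ d)
    (hτ : Fintype.card τ = 2 * Fintype.card σ) {α : ℝ} (hα : 0 < α)
    (hs : 8 ≤ α ^ 2 * Fintype.card σ) (hk : (k : ℝ) ≤ α * Fintype.card σ) {b₁ : ℝ≥0∞}
    (hb₁ : 2 * ((growth d (2 * Fintype.card σ) : ℝ≥0∞) *
      ENNReal.ofReal (Real.exp (-(α ^ 2 * Fintype.card σ / 16)))) ≤ b₁)
    (hb₂ : (growth d (2 * Fintype.card σ) : ℝ≥0∞) * 2⁻¹ ^ k ≤ b₁) (μ : PMF X) (c : X → Bool) :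
    (expect (prodPMF μ σ) fun x => expect (prodPMF μ (τ ⊕ ρ)) fun W =>
      (relabelThen hF alg (fun i => (x i, c (x i))) W).toOuterMeasure
        {h | ¬ ∀ f ∈ F, err μ c h ≤ err μ c f + (a + 3 * α)}) ≤ b + 3 * b₁ := by
  -- The deviation bound is one-sided. Using it for `c` and for its negation bounds errors from
  -- above and from below: one `α` each, and a third for the suboptimality `k`.
  let G : (X → Bool) → (σ → X) → Prop := fun c x => ∃ g ∈ xorWith F c,
    count (fun i => g (x i)) + α * Fintype.card σ ≤ Fintype.card σ * mass μ g
  have hG : ∀ c, (expect (prodPMF μ σ) fun x => ind (G c x)) ≤ b₁ := by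
    intro c
    refine (expect_exists_additive_le μ (xorWith F c) _ (fun w => ?_) hα hs).trans hb₁
    refine (card_patterns_xorWith_le F c w).trans ((card_patterns_le hd w).trans (le_of_eq ?_))
    rw [Fintype.card_sum, two_mul]
  have hs0 : (0 : ℝ) < Fintype.card σ := by
    by_contra hneg
    have : (Fintype.card σ : ℝ) = 0 := le_antisymm (not_lt.1 hneg) (Nat.cast_nonneg _)
    rw [this] at hs; norm_num at hs
  have hx : ∀ x : σ → X, (expect (prodPMF μ (τ ⊕ ρ)) fun W =>
      (relabelThen hF alg (fun i => (x i, c (x i))) W).toOuterMeasure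
        {h | ¬ ∀ f ∈ F, err μ c h ≤ err μ c f + (a + 3 * α)}) ≤
      (ind (G c x) + ind (G (fun x => !c x) x)) + (b₁ + b) := by
    intro x
    by_cases h1 : G c x
    · rw [ind_true h1]
      exact (expect_le_of_le _ fun r => toOuterMeasure_le_one _ _).trans
        (le_self_add.trans le_self_add)
    by_cases h2 : G (fun x => !c x) x
    · rw [ind_true h2]
      exact (expect_le_of_le _ fun r => toOuterMeasure_le_one _ _).trans
        (le_add_self.trans le_self_add)
    refine le_trans ?_ le_add_self
    refine (expect_relabelThen_le hF halg μ _ k (growth d (2 * Fintype.card σ)) ?_ _ ?_).trans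
      (add_le_add_left hb₂ b)
    · intro w
      rw [← hτ]
      exact card_patterns_le hd w
    · intro f' hf' hopt h hh
      simp only [Set.mem_ofPred_eq, not_forall, not_le, exists_prop] at hh
      obtain ⟨f, hf, hlt⟩ := hh
      have h3 : (disagreements (fun i => (x i, c (x i))) f' : ℝ) ≤
          disagreements (fun i => (x i, c (x i))) f + k := by exact_mod_cast (hopt f hf).le
      rw [disagreements_eq_count, disagreements_eq_count] at h3
      have h4 : Fintype.card σ * err μ c f' <
          count (fun i => f' (x i) ^^ c (x i)) + α * Fintype.card σ := by
        by_contra hcon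
        exact h1 ⟨_, ⟨f', hf', rfl⟩, not_lt.1 hcon⟩
      have h5 : Fintype.card σ * (1 - err μ c f) <
          (Fintype.card σ - count (fun i => f (x i) ^^ c (x i))) + α * Fintype.card σ := by
        by_contra hcon
        refine h2 ⟨_, ⟨f, hf, rfl⟩, ?_⟩
        have e1 : mass μ (fun x => f x ^^ !c x) = 1 - err μ c f := by
          rw [err, ← mass_not]; congr 1; ext x; cases f x <;> cases c x <;> rfl
        have e2 : count (fun i => f (x i) ^^ !c (x i)) =
            Fintype.card σ - count (fun i => f (x i) ^^ c (x i)) := by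
          rw [eq_sub_iff_add_eq, count, count, ← Finset.sum_add_distrib]
          have : ∀ i, bval (f (x i) ^^ !c (x i)) + bval (f (x i) ^^ c (x i)) = 1 := by
            intro i; cases f (x i) <;> cases c (x i) <;> simp [bval]
          rw [Finset.sum_congr rfl fun i _ => this i]
          simp
        simp only [e1, e2]
        exact not_lt.1 hcon
      simp only at h3
      have h6 : Fintype.card σ * err μ c f' < Fintype.card σ * (err μ c f + 3 * α) := by linarith
      have h7 := lt_of_mul_lt_mul_left h6 hs0.le
      have := err_triangle μ c f' h
      linarith
  refine (expect_mono _ hx).trans ?_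
  rw [expect_add, expect_const, expect_add]
  calc _ ≤ (b₁ + b₁) + (b₁ + b) := by gcongr <;> exact hG _
    _ = _ := by ring

end relabelThen

/-! ### Resampling and the learner at the last level. -/

/-- Privacy amplification in one slot: the entry is drawn uniformly from `κ`. -/
theorem expect_uniform_le {Z κ : Type*} [Fintype κ] [Nonempty κ] {φ : Z → ℝ≥0∞} {C δ : ℝ≥0∞}
    (hφ : ∀ z z', φ z ≤ C * φ z' + δ) {z z' : κ → Z} {i : κ} (h : ∀ j, j ≠ i → z j = z' j) :
    (expect (PMF.uniformOfFintype κ) fun j => φ (z j)) ≤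
      (1 + C / Fintype.card κ) * (expect (PMF.uniformOfFintype κ) fun j => φ (z' j)) +
        δ / Fintype.card κ := by
  classical
  set e := expect (PMF.uniformOfFintype κ) fun j => φ (z' j) with he
  -- The changed entry is compared with every `z' j` and averaged, not just with `z' i`; thus the
  -- extra term is a fraction of the whole expectation.
  have h1 : φ (z i) ≤ C * e + δ := by
    have := expect_mono (PMF.uniformOfFintype κ) fun j => hφ (z i) (z' j)
    rwa [expect_const, expect_add, expect_const_mul, expect_const] at this
  have hu : ∀ f : κ → ℝ≥0∞, expect (PMF.uniformOfFintype κ) f =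
      (Fintype.card κ : ℝ≥0∞)⁻¹ * ∑ j, f j := by
    intro f
    rw [expect, tsum_fintype, Finset.mul_sum]
    simp
  have h2 : (∑ j, φ (z j)) ≤ (∑ j, φ (z' j)) + φ (z i) := by
    rw [← Finset.add_sum_erase _ _ (Finset.mem_univ i), add_comm]
    gcongr
    refine (Finset.sum_le_sum fun j hj => ?_).trans
      (Finset.sum_le_sum_of_subset (Finset.erase_subset i Finset.univ))
    rw [h j (Finset.ne_of_mem_erase hj)]
  calc (expect (PMF.uniformOfFintype κ) fun j => φ (z j))
      ≤ (Fintype.card κ : ℝ≥0∞)⁻¹ * ((∑ j, φ (z' j)) + (C * e + δ)) := by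
        rw [hu]; gcongr; exact h2.trans (by gcongr)
    _ = _ := by
        rw [mul_add, ← hu, ← he, div_eq_mul_inv, div_eq_mul_inv]; ring

/-- Resampling with replacement from a database in which one entry changes. -/
theorem expect_resample_le {Z κ : Type*} [Fintype κ] [Nonempty κ] {C δ : ℝ≥0∞} {z z' : κ → Z}
    {i : κ} (h : ∀ j, j ≠ i → z j = z' j) (n : ℕ) (φ : (Fin n → Z) → ℝ≥0∞)
    (hφ : ∀ (t : Fin n) (S S' : Fin n → Z), (∀ j, j ≠ t → S j = S' j) → φ S ≤ C * φ S' + δ) :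
    (expect (iid (PMF.uniformOfFintype κ) n) fun J => φ fun t => z (J t)) ≤
      (1 + C / Fintype.card κ) ^ n *
        ((expect (iid (PMF.uniformOfFintype κ) n) fun J => φ fun t => z' (J t)) +
          n * (δ / Fintype.card κ)) := by
  induction n with
  | zero =>
    have : ∀ J : Fin 0 → κ, (fun t => z (J t)) = fun t => z' (J t) :=
      fun J => funext fun t => t.elim0
    simp [this]
  | succ n ih =>
    have hcons : ∀ (y : κ → Z) (x : κ) (v : Fin n → κ),
        (fun t => y ((Fin.cons x v : Fin (n + 1) → κ) t)) =
          (Fin.cons (y x) fun t => y (v t) : Fin (n + 1) → Z) := by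
      intro y x v
      ext t
      refine Fin.cases ?_ (fun t => ?_) t <;> simp
    simp only [expect_iid_succ, hcons]
    set r : ℝ≥0∞ := 1 + C / Fintype.card κ with hr
    set q : ℝ≥0∞ := δ / Fintype.card κ
    set u := PMF.uniformOfFintype κ
    have h1 : ∀ x, (expect (iid u n) fun v : Fin n → κ =>
        φ (Fin.cons (z x) fun t => z (v t))) ≤
        r ^ n * ((expect (iid u n) fun v : Fin n → κ =>
          φ (Fin.cons (z x) fun t => z' (v t))) + n * q) := by
      intro x
      refine ih (fun S => φ (Fin.cons (z x) S)) fun t S S' hS => hφ t.succ _ _ fun j hj => ?_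
      revert hj
      refine Fin.cases (fun _ => by simp) (fun j hj => ?_) j
      simpa using hS j (by simpa using hj)
    have h2 : (expect u fun x => expect (iid u n) fun v : Fin n → κ =>
        φ (Fin.cons (z x) fun t => z' (v t))) ≤
        r * (expect u fun x => expect (iid u n) fun v : Fin n → κ =>
          φ (Fin.cons (z' x) fun t => z' (v t))) + q := by
      rw [expect_comm, expect_comm u]
      refine (expect_mono _ fun v : Fin n → κ => expect_uniform_le (C := C) (δ := δ)
        (φ := fun y => φ (Fin.cons y fun t => z' (v t))) (fun y y' => hφ 0 _ _ fun j hj => ?_)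
        h).trans ?_
      · revert hj
        refine Fin.cases (fun h => absurd rfl h) (fun j _ => by simp) j
      · rw [expect_add, expect_const_mul, expect_const]
    have hr1 : 1 ≤ r := by rw [hr]; exact le_self_add
    calc _ ≤ expect u fun x => r ^ n * ((expect (iid u n) fun v : Fin n → κ =>
            φ (Fin.cons (z x) fun t => z' (v t))) + n * q) := expect_mono _ h1
      _ = r ^ n * ((expect u fun x => expect (iid u n) fun v : Fin n → κ =>
            φ (Fin.cons (z x) fun t => z' (v t))) + n * q) := by
          rw [expect_const_mul, expect_add, expect_const]
      _ ≤ r ^ n * ((r * (expect u fun x => expect (iid u n) fun v : Fin n → κ =>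
          φ (Fin.cons (z' x) fun t => z' (v t))) + q) + n * q) := by gcongr
      _ ≤ r ^ n * (r * ((expect u fun x => expect (iid u n) fun v : Fin n → κ =>
          φ (Fin.cons (z' x) fun t => z' (v t))) + (n + 1) * q)) := by
          gcongr
          rw [add_assoc, mul_add r]
          gcongr
          calc q + n * q = 1 * ((n + 1) * q) := by ring
            _ ≤ _ := by gcongr
      _ = _ := by push_cast; ring

theorem IsDP.le_of_agree {Z O : Type*} {n : ℕ} {ε δ : ℝ} (hε : 0 ≤ ε) {A : (Fin n → Z) → PMF O}
    (hA : IsDP ε δ A) (i : Fin n) (S T : Fin n → Z) (h : ∀ j, j ≠ i → S j = T j) (E : Set O) :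
    (A S).toOuterMeasure E ≤
      ENNReal.ofReal (Real.exp ε) * (A T).toOuterMeasure E + ENNReal.ofReal δ := by
  by_cases hi : S i = T i
  · have : S = T := funext fun j => if hj : j = i then hj ▸ hi else h j hj
    rw [this]
    refine le_trans ?_ le_self_add
    calc (A T).toOuterMeasure E = 1 * (A T).toOuterMeasure E := (one_mul _).symm
      _ ≤ _ := by gcongr; simpa using hε
  · exact hA S T ⟨i, hi, h⟩ E

/-- Run a learner on examples drawn with replacement from the given labeled examples. -/
noncomputable def resampleLearner {X ι : Type*} [Fintype ι] [Nonempty ι] {n : ℕ}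
    (A : Learner X n) (S : ι → X × Bool) (_ : Empty → X) : PMF (X → Bool) :=
  (iid (PMF.uniformOfFintype ι) n).bind fun J => A fun t => ((S (J t)).1, some (S (J t)).2)

/-- The loss is `(1 + e/N)^n ≤ exp(e n/N)`; with `N ≥ 2n` and `e ≤ 4` this is at most `e² < 8`. -/
theorem resampleLearner_labeled {X ι : Type*} [Fintype ι] [Nonempty ι] {n : ℕ} {δ : ℝ}
    {A : Learner X n} (hA : IsDP 1 δ A) (hn : 2 * n ≤ Fintype.card ι) (i : ι)
    (S S' : ι → X × Bool) (h : ∀ j, j ≠ i → S j = S' j) (R : Empty → X) (E : Set (X → Bool)) :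
    (resampleLearner A S R).toOuterMeasure E ≤
      8 * (resampleLearner A S' R).toOuterMeasure E + 8 * ENNReal.ofReal δ := by
  simp only [resampleLearner, toOuterMeasure_bind_eq]
  have := expect_resample_le h n (C := ENNReal.ofReal (Real.exp 1)) (δ := ENNReal.ofReal δ)
    (fun T => (A fun t => ((T t).1, some (T t).2)).toOuterMeasure E)
    (fun t S S' hS => hA.le_of_agree zero_le_one t _ _ (fun j hj => by rw [hS j hj]) E)
  refine this.trans ?_
  have hN : (0 : ℝ) < Fintype.card ι := by exact_mod_cast Fintype.card_pos
  have hnN : 2 * (n : ℝ) ≤ Fintype.card ι := by exact_mod_cast hn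
  have h8 : (1 + ENNReal.ofReal (Real.exp 1) / Fintype.card ι) ^ n ≤ 8 := by
    rw [← ENNReal.ofReal_natCast, ← ENNReal.ofReal_div_of_pos hN, ← ENNReal.ofReal_one,
      ← ENNReal.ofReal_add zero_le_one (by positivity), ← ENNReal.ofReal_pow (by positivity),
      show (8 : ℝ≥0∞) = ENNReal.ofReal 8 by simp]
    refine ENNReal.ofReal_le_ofReal ?_
    have he := Real.exp_one_lt_d9
    calc (1 + Real.exp 1 / Fintype.card ι) ^ n
        ≤ Real.exp (Real.exp 1 / Fintype.card ι) ^ n := by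
          gcongr; rw [add_comm]; exact Real.add_one_le_exp _
      _ = Real.exp (Real.exp 1 * (n / Fintype.card ι)) := by
          rw [← Real.exp_nat_mul]; congr 1; ring
      _ ≤ Real.exp (1 + 1) := by
          gcongr
          have : (n : ℝ) / Fintype.card ι ≤ 1 / 2 := by
            rw [div_le_div_iff₀ hN (by norm_num)]; linarith
          calc Real.exp 1 * (n / Fintype.card ι) ≤ 4 * (1 / 2) := by gcongr; linarith
            _ = _ := by norm_num
      _ ≤ 8 := by
          rw [Real.exp_add]; nlinarith [Real.exp_pos 1]
  have hδ : (n : ℝ≥0∞) * (ENNReal.ofReal δ / Fintype.card ι) ≤ ENNReal.ofReal δ := by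
    rw [← mul_div_assoc]
    refine ENNReal.div_le_of_le_mul ?_
    rw [mul_comm]
    gcongr
    omega
  calc _ ≤ 8 * ((expect (iid (PMF.uniformOfFintype ι) n) fun J =>
          (A fun t => ((S' (J t)).1, some (S' (J t)).2)).toOuterMeasure E) +
            ENNReal.ofReal δ) := by gcongr
    _ = _ := by ring

/-- Outputs on a subsample `Q` have a small error on the remaining points `R` only if they
generalize, even if the labels of `Q` come from a target chosen with knowledge of `R`. -/
theorem expect_exists_generalize_le {X ι : Type*} [Fintype ι] {F : Set (X → Bool)} {d n : ℕ}
    (hd : vcDim F ≤ d) {α : ℝ} (hα : 1 ≤ α * Fintype.card ι)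
    (hn : 2 * n ≤ Fintype.card ι) (μ : PMF X) (J : Fin n → ι)
    (Q : (Fin n → X × Bool) → PMF (X → Bool)) :
    (expect (prodPMF μ ι) fun x => ∑ π ∈ patterns F fun t => x (J t),
      expect (Q fun t => (x (J t), π t)) fun h => ind (∃ f ∈ F,
        count (fun i => f (x i) ^^ h (x i)) ≤ α * Fintype.card ι ∧ 16 * α < err μ h f)) ≤
      2 * (((growth d (2 * Fintype.card ι) ^ 2 : ℕ) : ℝ≥0∞) *
        ENNReal.ofReal (Real.exp (-(4 / 5 * (α * Fintype.card ι))))) := by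
  classical
  let R : Type _ := {i // i ∉ Set.range J}
  let e : ι ≃ {i // i ∈ Set.range J} ⊕ R := (Equiv.sumCompl (· ∈ Set.range J)).symm
  have heJ : ∀ t, e (J t) = Sum.inl ⟨J t, t, rfl⟩ := fun t =>
    (Equiv.symm_apply_eq _).2 rfl
  set N := Fintype.card ι
  have hcard : Fintype.card {i // i ∈ Set.range J} + Fintype.card R = N := by
    rw [← Fintype.card_sum]; exact (Fintype.card_congr e).symm
  have hcardJ : Fintype.card {i // i ∈ Set.range J} ≤ n := by
    have := Fintype.card_le_of_surjective _ (Set.rangeFactorization_surjective (f := J))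
    rwa [Fintype.card_fin] at this
  have hR1 : N ≤ 2 * Fintype.card R := by omega
  have hR1' : (N : ℝ) ≤ 2 * Fintype.card R := by exact_mod_cast hR1
  have hR2 : Fintype.card R ≤ N := by omega
  have hα0 : 0 < α := by
    by_contra hneg
    have : α * N ≤ 0 := mul_nonpos_of_nonpos_of_nonneg (not_lt.1 hneg) (Nat.cast_nonneg _)
    linarith
  set Γ := growth d (2 * N)
  set z := ENNReal.ofReal (Real.exp (-(4 / 5 * (α * N))))
  have hh : ∀ h : X → Bool, (expect (prodPMF μ R) fun y => ind (∃ f ∈ F,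
      count (fun i => f (y i) ^^ h (y i)) ≤ α * N ∧ 16 * α < err μ h f)) ≤ 2 * (Γ * z) := by
    intro h
    -- At least half of the points are undrawn, so `p₀ = 16 α |R|` is at least `8 α N`: it meets the
    -- threshold 8, dominates eight times the permitted count `α N`, and gives the exponent `4/5`.
    have hm := expect_exists_multiplicative_le (ι := R) μ (xorWith F h) Γ (fun w => ?_)
      (p₀ := 16 * α * Fintype.card R) (by nlinarith)
    · refine (expect_mono _ fun y => ind_mono ?_).trans (hm.trans ?_)
      · rintro ⟨f, hf, hc, he⟩
        have hle : 16 * α * Fintype.card R ≤ Fintype.card R * err μ h f := by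
          rw [mul_comm (Fintype.card R : ℝ)]; gcongr
        refine ⟨_, ⟨f, hf, rfl⟩, hle, ?_⟩
        unfold err at hle
        refine le_trans ?_ hle
        nlinarith
      · gcongr
        refine ENNReal.ofReal_le_ofReal (Real.exp_le_exp.2 ?_)
        nlinarith
    · refine (card_patterns_xorWith_le F h w).trans ((card_patterns_le hd w).trans ?_)
      refine growth_mono d ?_
      rw [Fintype.card_sum]
      omega
  rw [expect_prodPMF_reindex μ e, expect_prodPMF_sum]
  refine expect_le_of_le _ fun q => ?_
  simp only [heJ, Sum.elim_inl]
  rw [expect_finset_sum]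
  -- Once the drawn points `q` are fixed, the output for each labeling `π` is independent of the
  -- undrawn points. The sum over `π` is the union bound over target labels and supplies the second
  -- growth factor.
  calc _ ≤ ∑ π ∈ patterns F fun t => q ⟨J t, t, rfl⟩, 2 * (Γ * z) := by
        refine Finset.sum_le_sum fun π _ => ?_
        rw [expect_comm]
        refine expect_le_of_le _ fun h => le_trans (expect_mono _ fun y => ind_mono ?_) (hh h)
        rintro ⟨f, hf, hc, he⟩
        refine ⟨f, hf, le_trans ?_ hc, he⟩
        have : count (fun i => f (Sum.elim q y (e i)) ^^ h (Sum.elim q y (e i))) =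
            count (fun k => f (Sum.elim q y k) ^^ h (Sum.elim q y k)) :=
          Fintype.sum_equiv e _ _ fun _ => rfl
        rw [this, count, count, Fintype.sum_sum_type]
        simp only [Sum.elim_inr]
        exact le_add_of_nonneg_left (Finset.sum_nonneg fun _ _ => bval_nonneg _)
    _ ≤ Γ * (2 * (Γ * z)) := by
        rw [Finset.sum_const, nsmul_eq_mul]
        gcongr
        refine (card_patterns_le hd _).trans (growth_mono d ?_)
        rw [Fintype.card_fin]
        omega
    _ = _ := by push_cast; ring

theorem mass_map_uniform {X ι : Type*} [Fintype ι] [Nonempty ι] (x : ι → X) (g : X → Bool) :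
    Fintype.card ι * mass ((PMF.uniformOfFintype ι).map x) g = count fun i => g (x i) := by
  have hN : (0 : ℝ) < Fintype.card ι := by exact_mod_cast Fintype.card_pos
  have h : ENNReal.ofReal (mass ((PMF.uniformOfFintype ι).map x) g) =
      ENNReal.ofReal ((count fun i => g (x i)) / Fintype.card ι) := by
    rw [← expect_ind_eq_mass, expect_map, expect, tsum_fintype, div_eq_inv_mul, count,
      Finset.mul_sum, ENNReal.ofReal_sum_of_nonneg
        (fun i _ => mul_nonneg (by positivity) (bval_nonneg _))]
    refine Finset.sum_congr rfl fun i _ => ?_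
    rw [ENNReal.ofReal_mul (by positivity), ENNReal.ofReal_inv_of_pos hN, ENNReal.ofReal_natCast,
      PMF.uniformOfFintype_apply]
    congr 1
    cases g (x i) <;> simp [ind, bval]
  rw [ENNReal.ofReal_eq_ofReal_iff (mass_nonneg _ _) (div_nonneg (count_nonneg _) hN.le)] at h
  rw [h]; field_simp

/-- The accuracy of `A` is applied to the uniform distribution on the sample points, for every
target separately, so the target may depend on them. Passing to `μ` costs the factor 16 and `b₁`. -/
theorem resampleLearner_isRobustLearner {X ι : Type*} [Fintype ι] [Nonempty ι] {n d : ℕ}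
    {F : Set (X → Bool)} (hd : vcDim F ≤ d) {α β δ : ℝ} {A : Learner X n}
    (hA : IsPSSL α β 1 δ n F A) (hn : 2 * n ≤ Fintype.card ι) (hα : 1 ≤ α * Fintype.card ι)
    {b₁ : ℝ≥0∞} (hb₁ : 2 * (((growth d (2 * Fintype.card ι) ^ 2 : ℕ) : ℝ≥0∞) *
        ENNReal.ofReal (Real.exp (-(4 / 5 * (α * Fintype.card ι))))) ≤ b₁) :
    IsRobustLearner F (⋃ S, (A S).support) (16 * α) (ENNReal.ofReal β + b₁) (ENNReal.ofReal δ)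
      (resampleLearner A : (ι → X × Bool) → (Empty → X) → PMF (X → Bool)) where
  labeled := resampleLearner_labeled hA.2 hn
  unlabeled _ i := i.elim
  outputs S R := by
    rw [resampleLearner, PMF.support_bind]
    exact Set.iUnion₂_subset fun J _ => Set.subset_iUnion (fun S => (A S).support) _
  accurate μ := by
    let Q : (Fin n → X × Bool) → PMF (X → Bool) := fun T => A fun t => ((T t).1, some (T t).2)
    let Ψ : (ι → X) → (Fin n → ι) → ℝ≥0∞ := fun x J => ∑ π ∈ patterns F fun t => x (J t),
      expect (Q fun t => (x (J t), π t)) fun h => ind (∃ f ∈ F,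
        count (fun i => f (x i) ^^ h (x i)) ≤ α * Fintype.card ι ∧ 16 * α < err μ h f)
    have hsymm : ∀ f h : X → Bool, err μ h f = err μ f h := by
      intro f h
      unfold err
      simp only [Bool.xor_comm]
    have hx : ∀ x : ι → X, (⨆ f ∈ F, expect (prodPMF μ Empty) fun y =>
        (resampleLearner A (fun i => (x i, f (x i))) y).toOuterMeasure {h | 16 * α < err μ f h}) ≤
        ENNReal.ofReal β + expect (iid (PMF.uniformOfFintype ι) n) fun J => Ψ x J := by
      intro x
      refine iSup₂_le fun f hf => ?_
      refine expect_le_of_le _ fun y => ?_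
      have hacc := hA.1 f hf ((PMF.uniformOfFintype ι).map x)
      rw [outputDist, iid_map, toOuterMeasure_bind_eq, expect_map] at hacc
      have hlabel : ∀ J : Fin n → ι, labelFirst n f (fun i => x (J i)) =
          fun t => (x (J t), some (f (x (J t)))) := by
        intro J; ext1 t; simp [labelFirst]
      simp only [hlabel] at hacc
      rw [resampleLearner, toOuterMeasure_bind_eq]
      refine le_trans ?_ (add_le_add_left hacc _)
      rw [← expect_add]
      refine expect_mono _ fun J => ?_
      calc (A fun t => (x (J t), some (f (x (J t))))).toOuterMeasure {h | 16 * α < err μ f h}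
          ≤ (A fun t => (x (J t), some (f (x (J t))))).toOuterMeasure
              {h | ENNReal.ofReal α < genError ((PMF.uniformOfFintype ι).map x) f h} +
            expect (A fun t => (x (J t), some (f (x (J t))))) fun h => ind (∃ f ∈ F,
              count (fun i => f (x i) ^^ h (x i)) ≤ α * Fintype.card ι ∧
                16 * α < err μ h f) := by
            rw [toOuterMeasure_eq_expect, toOuterMeasure_eq_expect, ← expect_add]
            refine expect_mono _ fun h => ind_le_add fun hbad => ?_
            by_cases hlt : ENNReal.ofReal α < genError ((PMF.uniformOfFintype ι).map x) f h
            · exact Or.inl hlt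
            refine Or.inr ⟨f, hf, ?_, by rw [hsymm]; exact hbad⟩
            have hα0 : 0 ≤ α := by
              by_contra hneg
              have : α * Fintype.card ι ≤ 0 :=
                mul_nonpos_of_nonpos_of_nonneg (not_le.1 hneg).le (Nat.cast_nonneg _)
              linarith
            rw [genError_eq, ENNReal.ofReal_lt_ofReal_iff_of_nonneg hα0, not_lt] at hlt
            have := mass_map_uniform x fun x => f x ^^ h x
            rw [← this, mul_comm α]
            unfold err at hlt
            simp only [Bool.xor_comm (f _)]
            gcongr
        _ ≤ _ := by
            gcongr
            exact Finset.single_le_sum (f := fun π => expect (Q fun t => (x (J t), π t)) fun h =>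
              ind (∃ f ∈ F, count (fun i => f (x i) ^^ h (x i)) ≤ α * Fintype.card ι ∧
                16 * α < err μ h f)) (fun _ _ => zero_le)
              (mem_patterns.2 ⟨f, hf, fun t => rfl⟩)
    refine (expect_mono _ hx).trans ?_
    rw [expect_add, expect_const, expect_comm]
    gcongr
    exact expect_le_of_le _ fun J =>
      (expect_exists_generalize_le hd hα hn μ J Q).trans hb₁

/-! ### Subsampling, privacy amplification and the agnostic learner. -/

theorem expect_prodPMF_unit {X : Type*} (μ : PMF X) (f : (Unit → X) → ℝ≥0∞) :
    expect (prodPMF μ Unit) f = expect μ fun x => f fun _ => x :=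
  expect_equiv μ (prodPMF μ Unit) (Equiv.funUnique Unit X).symm
    (fun x => by simp [prodPMF_apply]) f

theorem expect_prodPMF_update {X ι : Type*} [Fintype ι] [DecidableEq ι] (μ : PMF X) (i : ι)
    (f : (ι → X) → ℝ≥0∞) :
    expect (prodPMF μ ι) f =
      expect (prodPMF μ ι) fun v => expect μ fun x => f (Function.update v i x) := by
  let j : ι → Unit ⊕ ι := fun t => if t = i then Sum.inl () else Sum.inr t
  have hj : Function.Injective j := by
    intro s t h
    simp only [j] at h
    split_ifs at h <;> simp_all
  rw [← expect_prodPMF_comp_injective μ j hj f, expect_prodPMF_sum, expect_prodPMF_unit,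
    expect_comm]
  refine congrArg _ (funext fun v => congrArg _ (funext fun x => congrArg f (funext fun t => ?_)))
  by_cases h : t = i
  · subst h; simp [j]
  · simp [j, h]

/-- Run `M` on a database whose entry in slot `t` is drawn uniformly from the `k` entries
`e (t, ·)`. -/
noncomputable def subsampleLearner {X Λ : Type*} [Fintype Λ] {k N : ℕ} [NeZero k]
    (e : Λ × Fin k → Fin N) (M : (Λ → X × Option Bool) → PMF (X → Bool)) : Learner X N :=
  fun S => (prodPMF (PMF.uniformOfFintype (Fin k)) Λ).bind fun J => M fun t => S (e (t, J t))

/-- A changed entry affects one slot and is selected with probability `1/k`. Conditioning on the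
other slots gives the factor `1 + C/k ≤ 1 + ε ≤ e^ε` and the additive term `(C/k) δ ≤ δ`. -/
theorem subsampleLearner_isDP {X Λ : Type*} [Fintype Λ] {k N : ℕ} [NeZero k]
    (e : Λ × Fin k ≃ Fin N) {M : (Λ → X × Option Bool) → PMF (X → Bool)} {C ε δ : ℝ} (hC : 0 ≤ C)
    (hk : C ≤ k * ε) (hkδ : C ≤ k)
    (hM : ∀ (t : Λ) (Z Z' : Λ → X × Option Bool), (∀ j, j ≠ t → Z j = Z' j) → ∀ E,
      (M Z).toOuterMeasure E ≤ ENNReal.ofReal C * (M Z').toOuterMeasure E +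
        ENNReal.ofReal C * ENNReal.ofReal δ) :
    IsDP ε δ (subsampleLearner e M) := by
  classical
  rintro S T ⟨i, -, hST⟩ E
  obtain ⟨⟨t₀, j₀⟩, rfl⟩ := e.surjective i
  have hk0 : (0 : ℝ) < k := by exact_mod_cast NeZero.pos k
  simp only [subsampleLearner, toOuterMeasure_bind_eq]
  set u := PMF.uniformOfFintype (Fin k)
  rw [expect_prodPMF_update u t₀ fun J => (M fun t => S (e (t, J t))).toOuterMeasure E,
    expect_prodPMF_update u t₀ fun J => (M fun t => T (e (t, J t))).toOuterMeasure E]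
  have hJ : ∀ J : Λ → Fin k, (expect u fun x =>
      (M fun t => S (e (t, Function.update J t₀ x t))).toOuterMeasure E) ≤
      ENNReal.ofReal (Real.exp ε) * (expect u fun x =>
      (M fun t => T (e (t, Function.update J t₀ x t))).toOuterMeasure E) + ENNReal.ofReal δ := by
    intro J
    have hupd : ∀ (R : Fin N → X × Option Bool) (x : Fin k),
        (fun t => R (e (t, Function.update J t₀ x t))) =
          Function.update (fun t => R (e (t, J t))) t₀ (R (e (t₀, x))) := by
      intro R x
      ext1 t
      by_cases h : t = t₀
      · subst h; simp
      · simp [h]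
    have hoff : ∀ z, Function.update (fun t => T (e (t, J t))) t₀ z =
        Function.update (fun t => S (e (t, J t))) t₀ z := by
      intro z
      ext1 t
      by_cases h : t = t₀
      · subst h; simp
      · simp only [Function.update_of_ne h]
        exact (hST _ (by simp [h])).symm
    simp only [hupd, hoff]
    have := expect_uniform_le (κ := Fin k) (C := ENNReal.ofReal C)
      (δ := ENNReal.ofReal C * ENNReal.ofReal δ)
      (φ := fun z => (M (Function.update (fun t => S (e (t, J t))) t₀ z)).toOuterMeasure E)
      (fun z z' => hM t₀ _ _ (fun j hj => by simp [hj]) E)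
      (z := fun j => S (e (t₀, j))) (z' := fun j => T (e (t₀, j))) (i := j₀)
      (fun j hj => hST _ (by simp [hj]))
    refine this.trans ?_
    rw [Fintype.card_fin]
    have hkk : (k : ℝ≥0∞) = ENNReal.ofReal k := by simp
    gcongr
    · rw [hkk, ← ENNReal.ofReal_div_of_pos hk0, ← ENNReal.ofReal_one,
        ← ENNReal.ofReal_add zero_le_one (by positivity)]
      refine ENNReal.ofReal_le_ofReal ?_
      have : C / k ≤ ε := by rw [div_le_iff₀ hk0]; linarith
      linarith [Real.add_one_le_exp ε]
    · refine ENNReal.div_le_of_le_mul ?_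
      rw [mul_comm, hkk]
      gcongr
  refine (expect_mono _ hJ).trans ?_
  rw [expect_add, expect_const_mul, expect_const]

/-- Different slots draw from disjoint groups of entries, so the selected points are i.i.d. for each
choice `J`. -/
theorem outputDist_subsampleLearner {X Λ : Type*} [Fintype Λ] {k N : ℕ} [NeZero k]
    (e : Λ × Fin k ≃ Fin N) (M : (Λ → X × Option Bool) → PMF (X → Bool)) (m : ℕ) (c : X → Bool)
    (μ : PMF X) (M' : (Λ → X) → PMF (X → Bool))
    (hM : ∀ (J : Λ → Fin k) (x : Fin N → X),
      M (fun t => labelFirst m c x (e (t, J t))) = M' fun t => x (e (t, J t)))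
    (E : Set (X → Bool)) :
    (outputDist (subsampleLearner e M) m c μ).toOuterMeasure E =
      expect (prodPMF μ Λ) fun y => (M' y).toOuterMeasure E := by
  simp only [outputDist, subsampleLearner, toOuterMeasure_bind_eq, hM, iid_eq_prodPMF]
  rw [expect_comm]
  have : ∀ J : Λ → Fin k, (expect (prodPMF μ (Fin N)) fun x =>
      (M' fun t => x (e (t, J t))).toOuterMeasure E) =
      expect (prodPMF μ Λ) fun y => (M' y).toOuterMeasure E := by
    intro J
    refine expect_prodPMF_comp_injective μ (fun t => e (t, J t)) (fun s t h => ?_)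
      fun y => (M' y).toOuterMeasure E
    have := e.injective h
    simp only [Prod.mk.injEq] at this
    exact this.1
  simp only [this, expect_const]

theorem competesWith_of_forall {X : Type*} {n : ℕ} {α β : ℝ} (hα : 0 ≤ α) (hβ : 0 ≤ β) {m : ℕ}
    {F : Set (X → Bool)} {B : Learner X n}
    (h : ∀ c μ, (outputDist B m c μ).toOuterMeasure
      {h | ¬ ∀ f ∈ F, err μ c h ≤ err μ c f + α} ≤ ENNReal.ofReal β) :
    CompetesWith α β m F B := by
  intro c μ
  have h1 := expect_ind_not (outputDist B m c μ) fun h => ∀ f ∈ F, err μ c h ≤ err μ c f + α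
  have h2 := h c μ
  rw [toOuterMeasure_eq_expect] at h2
  rw [ENNReal.ofReal_sub _ hβ, ENNReal.ofReal_one]
  rw [tsub_le_iff_right, ← h1, toOuterMeasure_eq_expect]
  refine add_le_add (expect_mono _ fun g => ind_mono fun hg => ?_) h2
  change genError μ c g ≤ _
  rw [← tsub_le_iff_right]
  refine le_iInf₂ fun f hf => ?_
  rw [tsub_le_iff_right]
  rw [genError_eq, genError_eq, ← ENNReal.ofReal_add (err_nonneg _ _ _) hα]
  exact ENNReal.ofReal_le_ofReal (hg f hf)

/-- The private agnostic learner built from a robust learner by relabeling and subsampling. -/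
theorem exists_learner_of_isRobustLearner {X : Type*} {F H : Set (X → Bool)} (hF : F.Nonempty)
    {s t r k d q : ℕ} [NeZero k] (hts : t = 2 * s) {ε δ a α b b₁ : ℝ} (hk : 32 ≤ k * ε)
    (hkδ : 32 ≤ (k : ℝ)) (hα : 0 < α) (ha : 0 ≤ a) (hb : 0 ≤ b) (hb₁ : 0 ≤ b₁)
    {alg : (Fin t → X × Bool) → (Fin r → X) → PMF (X → Bool)}
    (halg : IsRobustLearner F H a (ENNReal.ofReal b) (ENNReal.ofReal δ) alg)
    (hd : vcDim F ≤ d) (hs : 8 ≤ α ^ 2 * s) (hq : (q : ℝ) ≤ α * s)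
    (hΓ₁ : 2 * ((growth d (2 * s) : ℝ≥0∞) * ENNReal.ofReal (Real.exp (-(α ^ 2 * s / 16)))) ≤
      ENNReal.ofReal b₁)
    (hΓ₂ : (growth d (2 * s) : ℝ≥0∞) * 2⁻¹ ^ q ≤ ENNReal.ofReal b₁) :
    ∃ B : Learner X ((s + t) * k + r * k), IsDP ε δ B ∧
      CompetesWith (a + 3 * α) (b + 3 * b₁) ((s + t) * k) F B ∧ OutputsIn H B := by
  let Λ := Fin s ⊕ (Fin t ⊕ Fin r)
  -- Both the `s` and the `t` block are placed among the labeled entries, although the labels of the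
  -- `t` block are discarded. Their sizes depend on the VC dimension and may not enter the bound on
  -- `u`.
  let e : Λ × Fin k ≃ Fin ((s + t) * k + r * k) :=
    ((Equiv.sumAssoc (Fin s) (Fin t) (Fin r)).symm.prodCongr (Equiv.refl (Fin k))).trans
      ((Equiv.sumProdDistrib (Fin s ⊕ Fin t) (Fin r) (Fin k)).trans
        (((finSumFinEquiv.prodCongr (Equiv.refl (Fin k))).trans finProdFinEquiv).sumCongr
          finProdFinEquiv |>.trans finSumFinEquiv))
  have he : ∀ i j, (e (Sum.inl i, j) : ℕ) < (s + t) * k := by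
    intro i j
    have : e (Sum.inl i, j) = Fin.castAdd (r * k)
        (finProdFinEquiv (finSumFinEquiv (Sum.inl i : Fin s ⊕ Fin t), j)) := rfl
    rw [this, Fin.val_castAdd]
    exact Fin.is_lt _
  let M : (Λ → X × Option Bool) → PMF (X → Bool) := fun Z =>
    -- The value `false` for a missing label is arbitrary: privacy must hold on all databases, while
    -- accuracy concerns only those where this block is labeled.
    relabelThen hF alg (fun i => ((Z (Sum.inl i)).1, (Z (Sum.inl i)).2.getD false))
      fun i => (Z (Sum.inr i)).1
  let M' : (X → Bool) → (Λ → X) → PMF (X → Bool) := fun c y =>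
    relabelThen hF alg (fun i => (y (Sum.inl i), c (y (Sum.inl i)))) fun i => y (Sum.inr i)
  refine ⟨subsampleLearner e M, ?_, ?_, ?_⟩
  · refine subsampleLearner_isDP e (C := 32) (by norm_num) hk hkδ fun t Z Z' h E => ?_
    have h32 : ENNReal.ofReal 32 = 32 := by simp
    rw [h32]
    rcases t with t | t
    · have hr : ∀ i, Z (Sum.inr i) = Z' (Sum.inr i) := fun i => h _ (by simp)
      simp only [M, hr]
      refine (relabelThen_labeled hF alg (ENNReal.ofReal δ) t _
        (fun i => ((Z' (Sum.inl i)).1, (Z' (Sum.inl i)).2.getD false)) (fun j hj => ?_) _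
        E).trans ?_
      · rw [h _ fun hji => hj (Sum.inl.inj hji)]
      · gcongr <;> norm_num
    · have hl : ∀ i, Z (Sum.inl i) = Z' (Sum.inl i) := fun i => h _ (by simp)
      simp only [M, hl]
      refine relabelThen_unlabeled hF halg _ t _ _ (fun j hj => ?_) E
      rw [h _ fun hji => hj (Sum.inr.inj hji)]
  · refine competesWith_of_forall (by positivity) (by positivity) fun c μ => ?_
    rw [outputDist_subsampleLearner e M _ c μ (M' c), expect_prodPMF_sum]
    · refine (expect_relabelThen_agnostic_le hF halg (σ := Fin s) hd (by simpa using hts) hα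
        (by simpa using hs) (by simpa using hq) (b₁ := ENNReal.ofReal b₁) (by simpa using hΓ₁)
        (by simpa using hΓ₂) μ c).trans (le_of_eq ?_)
      rw [ENNReal.ofReal_add hb (by positivity), ENNReal.ofReal_mul (by norm_num)]
      simp
    · intro J x
      simp [M, M', labelFirst, he]
  · intro S
    rw [subsampleLearner, PMF.support_bind]
    exact Set.iUnion₂_subset fun J _ => relabelThen_outputs hF halg _ _

/-! ### The chain of doublings. -/

theorem IsRobustLearner.mono {X σ ρ : Type*} [Fintype σ] [Fintype ρ] {F H : Set (X → Bool)}
    {a a' : ℝ} {b b' D : ℝ≥0∞} {alg : (σ → X × Bool) → (ρ → X) → PMF (X → Bool)}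
    (h : IsRobustLearner F H a b D alg) (ha : a ≤ a') (hb : b ≤ b') :
    IsRobustLearner F H a' b' D alg where
  labeled := h.labeled
  unlabeled := h.unlabeled
  outputs := h.outputs
  accurate μ := by
    refine le_trans (expect_mono _ fun x => iSup₂_mono fun f _ => expect_mono _ fun y =>
      toOuterMeasure_mono' _ fun g hg => ?_) ((h.accurate μ).trans hb)
    exact lt_of_le_of_lt ha hg

theorem IsRobustLearner.reindex {X σ ρ ρ' : Type*} [Fintype σ] [Fintype ρ] [Fintype ρ']
    {F H : Set (X → Bool)} {a : ℝ} {b D : ℝ≥0∞}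
    {alg : (σ → X × Bool) → (ρ → X) → PMF (X → Bool)}
    (h : IsRobustLearner F H a b D alg) (e : ρ ≃ ρ') :
    IsRobustLearner F H a b D fun S (R : ρ' → X) => alg S fun k => R (e k) where
  labeled i S S' hS R E := h.labeled i S S' hS _ E
  unlabeled S i R R' hR E := by
    refine h.unlabeled S (e.symm i) _ _ (fun j hj => hR _ fun hji => hj ?_) E
    rw [← hji, e.symm_apply_apply]
  outputs S R := h.outputs S _
  accurate μ := by
    refine le_trans (le_of_eq ?_) (h.accurate μ)
    refine congrArg _ (funext fun x => iSup_congr fun f => iSup_congr fun _ => ?_)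
    exact (expect_prodPMF_reindex μ e fun y =>
      (alg (fun i => (x i, f (x i))) y).toOuterMeasure {h | a < err μ f h}).symm

theorem inv_two_pow_floor_le (x : ℝ) :
    (2⁻¹ : ℝ≥0∞) ^ ⌊x⌋₊ ≤ ENNReal.ofReal (2 * Real.exp (-(2 * x / 3))) := by
  have h2 : (2⁻¹ : ℝ≥0∞) = ENNReal.ofReal (1 / 2) := by
    rw [one_div, ENNReal.ofReal_inv_of_pos (by norm_num)]; norm_num
  rw [h2, ← ENNReal.ofReal_pow (by norm_num)]
  refine ENNReal.ofReal_le_ofReal ?_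
  have hl := Real.log_two_gt_d9
  have hfl := (Nat.lt_floor_add_one x).le
  have h3 : (1 / 2 : ℝ) ^ (⌊x⌋₊ + 1) ≤ Real.exp (-(2 * x / 3)) := by
    have : (1 / 2 : ℝ) = Real.exp (-Real.log 2) := by
      rw [Real.exp_neg, Real.exp_log (by norm_num)]; norm_num
    rw [this, ← Real.exp_nat_mul]
    refine Real.exp_le_exp.2 ?_
    push_cast
    nlinarith
  rw [pow_succ] at h3
  linarith

/-- Induction downwards from level `L`, with `j = L - i`. The bounds are tails of series:
`2(i+2)/2^i` sums `(j+1)/2^j` over `j ≥ i`, and `4/2^i` sums `2/2^j`; the remaining `16 α` and `2 β`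
come from the last level. The cardinality identity counts the blocks of sizes `s * 2 ^ (i+1), …, s *
2 ^ L`. -/
theorem exists_isRobustLearner {X : Type*} {F : Set (X → Bool)} (hF : F.Nonempty) {d n s : ℕ}
    (hd : vcDim F ≤ d) {α β δ : ℝ} (hα : 0 < α) (hβ : 0 ≤ β) {A : Learner X n}
    (hA : IsPSSL α β 1 δ n F A) (hs : 8 ≤ α * s)
    (hkey : ∀ i : ℕ, 2 * (growth d (2 * (s * 2 ^ i)) : ℝ) ^ 2 *
      Real.exp (-(α * (i + 1) * s / 12)) ≤ β / 2 ^ i)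
    {L : ℕ} (hL : 2 * n ≤ s * 2 ^ L) (j : ℕ) : ∀ i : ℕ, i + j = L →
    ∃ (ρ : Type) (_ : Fintype ρ) (alg : (Fin (s * 2 ^ i) → X × Bool) → (ρ → X) → PMF (X → Bool)),
      Fintype.card ρ + s * 2 ^ (i + 1) = s * 2 ^ (L + 1) ∧
      IsRobustLearner F (⋃ S, (A S).support) (16 * α + α * (2 * (i + 2) / 2 ^ i))
        (ENNReal.ofReal (2 * β + 4 * (β / 2 ^ i))) (ENNReal.ofReal δ) alg := by
  have hs0 : 0 < s := by
    rcases Nat.eq_zero_or_pos s with h | h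
    · rw [h] at hs; norm_num at hs
    · exact h
  induction j with
  | zero =>
    rintro i rfl
    have hpos : 0 < s * 2 ^ i := by positivity
    have : Nonempty (Fin (s * 2 ^ i)) := ⟨⟨0, hpos⟩⟩
    have hi : ((i : ℝ) + 1) ≤ 2 ^ i := by
      have := Nat.lt_two_pow_self (n := i)
      exact_mod_cast this
    refine ⟨Empty, inferInstance, resampleLearner A, by simp, ?_⟩
    refine IsRobustLearner.mono (resampleLearner_isRobustLearner hd hA (by simpa using hL) ?_
      (b₁ := ENNReal.ofReal β) ?_) ?_ ?_
    · rw [Fintype.card_fin]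
      push_cast
      have h1 : (1 : ℝ) ≤ 2 ^ i := one_le_pow₀ (by norm_num)
      nlinarith
    · rw [Fintype.card_fin, ← ENNReal.ofReal_natCast,
        ← ENNReal.ofReal_mul (by positivity), show (2 : ℝ≥0∞) = ENNReal.ofReal 2 by simp,
        ← ENNReal.ofReal_mul (by norm_num)]
      refine ENNReal.ofReal_le_ofReal ?_
      have h1 : β / 2 ^ i ≤ β := div_le_self hβ (one_le_pow₀ (by norm_num))
      refine le_trans ?_ ((hkey i).trans h1)
      push_cast
      rw [← mul_assoc]
      gcongr
      have : α * s * (i + 1) ≤ α * s * 2 ^ i := by gcongr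
      have h0 : 0 ≤ α * s * (i + 1) := by positivity
      nlinarith
    · have : 0 ≤ α * (2 * ((i : ℝ) + 2) / 2 ^ i) := by positivity
      linarith
    · rw [← ENNReal.ofReal_add hβ hβ]
      refine ENNReal.ofReal_le_ofReal ?_
      have : 0 ≤ β / 2 ^ i := by positivity
      linarith
  | succ j ih =>
    intro i hi
    obtain ⟨ρ, hρ, alg, hcard, halg⟩ := ih (i + 1) (by omega)
    -- The logarithm of the number of patterns and that of `2^i/β` grow linearly in `i`, hence the
    -- factor `i + 1`; the error `p₀ / (s * 2 ^ i)` is still summable.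
    set p₀ : ℝ := α * (i + 1) * s with hp₀
    have h2i : (0 : ℝ) < 2 ^ i := by positivity
    have hp8 : 8 ≤ p₀ := by
      rw [hp₀]
      have : α * s * 1 ≤ α * s * (i + 1) := by
        gcongr; linarith [(Nat.cast_nonneg i : (0 : ℝ) ≤ i)]
      nlinarith
    have hfl : (⌊p₀ / 8⌋₊ : ℝ) ≤ p₀ / 8 := Nat.floor_le (by linarith)
    have hG1 : (1 : ℝ) ≤ growth d (2 * (s * 2 ^ i)) := by exact_mod_cast one_le_growth _ _
    have hkeyi := hkey i
    refine ⟨Fin (s * 2 ^ (i + 1)) ⊕ ρ, inferInstance, relabelThen hF alg, ?_, ?_⟩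
    · rw [Fintype.card_sum, Fintype.card_fin, ← hcard, pow_succ 2 (i + 1)]
      ring
    · have := IsRobustLearner.relabelThen (σ := Fin (s * 2 ^ i)) hF halg (k := ⌊p₀ / 8⌋₊)
        (p₀ := p₀) (a₁ := α * (i + 1) / 2 ^ i) (b₁ := ENNReal.ofReal (β / 2 ^ i)) hd
        (by rw [Fintype.card_fin]; positivity)
        (by rw [Fintype.card_fin, Fintype.card_fin, pow_succ]; ring) hp8 (by linarith) ?_ ?_ ?_
      · convert this using 1
        · push_cast; field_simp; ring
        · rw [show (2 : ℝ≥0∞) = ENNReal.ofReal 2 by simp, ← ENNReal.ofReal_mul (by norm_num),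
            ← ENNReal.ofReal_add (by positivity) (by positivity)]
          congr 1
          field_simp; ring
      · rw [Fintype.card_fin, hp₀]
        push_cast
        refine le_of_eq ?_
        field_simp
      · rw [Fintype.card_fin, ← ENNReal.ofReal_natCast,
          ← ENNReal.ofReal_mul (by positivity), show (2 : ℝ≥0∞) = ENNReal.ofReal 2 by simp,
          ← ENNReal.ofReal_mul (by norm_num)]
        refine ENNReal.ofReal_le_ofReal (le_trans ?_ hkeyi)
        push_cast
        rw [← mul_assoc]
        gcongr
        norm_num
      · rw [Fintype.card_fin]
        refine le_trans (mul_le_mul_right (inv_two_pow_floor_le _) _) ?_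
        rw [← ENNReal.ofReal_natCast, ← ENNReal.ofReal_mul (by positivity)]
        refine ENNReal.ofReal_le_ofReal (le_trans ?_ hkeyi)
        rw [show 2 * (p₀ / 8) / 3 = p₀ / 12 by ring, ← mul_assoc, mul_comm _ (2 : ℝ)]
        gcongr
        nlinarith

/-! ### Numerical estimates for the sample size. -/

section NumericBounds

variable {d : ℕ} {α β : ℝ}

/-- In `e * 2s * 2^i / d` the constant 4000, the factor `l` and `α⁻²` are at most `e^l`, `e^(l-1)`
and `e^(2l)`. -/
theorem growth_le_exp (hd : 0 < d) (hα : 0 < α) {l : ℝ} (hl1 : 1 ≤ l) (hl : 4000 ≤ Real.exp l)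
    (hlα : 1 / α ≤ Real.exp l) {s : ℕ} (hs1 : d ≤ s) (hs : (s : ℝ) ≤ 2000 * d * l / α ^ 2)
    (i : ℕ) : (growth d (2 * (s * 2 ^ i)) : ℝ) ≤ Real.exp (d * (4 * l + i)) := by
  have hd' : (0 : ℝ) < d := by exact_mod_cast hd
  have h2 : (2 : ℝ) ≤ Real.exp 1 := by linarith [Real.add_one_le_exp (1 : ℝ)]
  have hk : d ≤ 2 * (s * 2 ^ i) := by
    have : 1 ≤ 2 ^ i := Nat.one_le_two_pow
    nlinarith
  have h2i : (2 : ℝ) ^ i ≤ Real.exp i := by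
    calc (2 : ℝ) ^ i ≤ Real.exp 1 ^ i := by gcongr
      _ = Real.exp i := by rw [← Real.exp_nat_mul]; simp
  rw [Real.exp_nat_mul]
  refine (growth_le hd hk).trans (pow_le_pow_left₀ (by positivity) ?_ d)
  push_cast
  calc Real.exp 1 * (2 * (s * 2 ^ i)) / d
      ≤ Real.exp 1 * (2 * ((2000 * d * l / α ^ 2) * Real.exp i)) / d := by gcongr
    _ = Real.exp 1 * 4000 * l * (1 / α) ^ 2 * Real.exp i := by field_simp; ring
    _ ≤ Real.exp 1 * Real.exp l * Real.exp (l - 1) * Real.exp l ^ 2 * Real.exp i := by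
        gcongr
        linarith [Real.add_one_le_exp (l - 1)]
    _ = Real.exp (4 * l + i) := by
        rw [← Real.exp_nat_mul, ← Real.exp_add, ← Real.exp_add, ← Real.exp_add, ← Real.exp_add]
        congr 1
        push_cast
        ring

theorem two_mul_growth_sq_mul_exp_le (hd : 0 < d) (hα : 0 < α) (hα1 : α ≤ 1) (hβ : 0 < β) {l : ℝ}
    (hl1 : 1 ≤ l) (hl : 4000 ≤ Real.exp l) (hlα : 1 / α ≤ Real.exp l) (hlβ : 1 / β ≤ Real.exp l)
    {s : ℕ} (hs1 : d ≤ s) (hs : (s : ℝ) ≤ 2000 * d * l / α ^ 2) (hs2 : 1000 * d * l ≤ α ^ 2 * s)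
    (i : ℕ) : 2 * (growth d (2 * (s * 2 ^ i)) : ℝ) ^ 2 * Real.exp (-(α * (i + 1) * s / 12)) ≤
      β / 2 ^ i := by
  have hd' : (1 : ℝ) ≤ d := by exact_mod_cast hd
  have h2 : (2 : ℝ) ≤ Real.exp 1 := by linarith [Real.add_one_le_exp (1 : ℝ)]
  have h2i : (2 : ℝ) ^ i ≤ Real.exp i := by
    calc (2 : ℝ) ^ i ≤ Real.exp 1 ^ i := by gcongr
      _ = Real.exp i := by rw [← Real.exp_nat_mul]; simp
  have hβl : Real.exp (-l) ≤ β := by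
    rw [Real.exp_neg, inv_le_comm₀ (Real.exp_pos _) hβ, ← one_div]; exact hlβ
  have hαs : 1000 * d * l ≤ α * s := by
    refine hs2.trans ?_
    gcongr
    nlinarith
  calc 2 * (growth d (2 * (s * 2 ^ i)) : ℝ) ^ 2 * Real.exp (-(α * (i + 1) * s / 12))
      ≤ Real.exp 1 * Real.exp (d * (4 * l + i)) ^ 2 * Real.exp (-(α * (i + 1) * s / 12)) := by
        gcongr
        exact growth_le_exp hd hα hl1 hl hlα hs1 hs i
    _ = Real.exp (1 + 2 * (d * (4 * l + i)) - α * (i + 1) * s / 12) := by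
        rw [← Real.exp_nat_mul, ← Real.exp_add, ← Real.exp_add]
        congr 1
    _ ≤ Real.exp (-l - i) := by
        refine Real.exp_le_exp.2 ?_
        have hi : (0 : ℝ) ≤ i := Nat.cast_nonneg i
        have h1 : 1000 * d * l * (i + 1) ≤ α * s * (i + 1) := by gcongr
        have h3 : l ≤ d * l := by nlinarith
        have h4 : (d : ℝ) * i ≤ d * l * i := by
          have : (d : ℝ) * i * 1 ≤ d * i * l := by gcongr
          linarith
        have h5 : (i : ℝ) ≤ d * l * i := by
          have : 1 * (i : ℝ) ≤ d * i := by gcongr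
          linarith
        nlinarith
    _ = Real.exp (-l) / Real.exp i := Real.exp_sub _ _
    _ ≤ β / 2 ^ i := by gcongr

theorem two_mul_growth_mul_exp_le (hd : 0 < d) (hα : 0 < α) (hβ : 0 < β) {l : ℝ}
    (hl1 : 1 ≤ l) (hl : 4000 ≤ Real.exp l) (hlα : 1 / α ≤ Real.exp l) (hlβ : 1 / β ≤ Real.exp l)
    {s : ℕ} (hs1 : d ≤ s) (hs : (s : ℝ) ≤ 2000 * d * l / α ^ 2)
    (hs2 : 1000 * d * l ≤ α ^ 2 * s) :
    2 * (growth d (2 * s) : ℝ) * Real.exp (-(α ^ 2 * s / 16)) ≤ β := by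
  have hd' : (1 : ℝ) ≤ d := by exact_mod_cast hd
  have h2 : (2 : ℝ) ≤ Real.exp 1 := by linarith [Real.add_one_le_exp (1 : ℝ)]
  have hβl : Real.exp (-l) ≤ β := by
    rw [Real.exp_neg, inv_le_comm₀ (Real.exp_pos _) hβ, ← one_div]; exact hlβ
  have hG := growth_le_exp hd hα hl1 hl hlα hs1 hs 0
  simp only [pow_zero, mul_one, Nat.cast_zero, add_zero] at hG
  refine le_trans ?_ hβl
  calc 2 * (growth d (2 * s) : ℝ) * Real.exp (-(α ^ 2 * s / 16))
      ≤ Real.exp 1 * Real.exp (d * (4 * l)) * Real.exp (-(α ^ 2 * s / 16)) := by gcongr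
    _ = Real.exp (1 + d * (4 * l) - α ^ 2 * s / 16) := by
        rw [← Real.exp_add, ← Real.exp_add]; congr 1
    _ ≤ Real.exp (-l) := by
        refine Real.exp_le_exp.2 ?_
        have h3 : l ≤ d * l := by nlinarith
        nlinarith

end NumericBounds

/-! ### Finiteness of the VC dimension. -/

/-- A class with a large shattered set has no accurate learner with few examples. -/
theorem vcDim_ne_top {X : Type*} {F : Set (X → Bool)} {α β : ℝ} (hα : 0 ≤ α) (hβ : 0 ≤ β)
    (hαβ : α + β < 1 / 4) {n : ℕ} {A : Learner X n} (hA : IsSSL α β n F A) : vcDim F ≠ ⊤ := by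
  classical
  intro htop
  -- The no-free-lunch argument on more than `2n` shattered points with uniform random labels: over
  -- half of them are unseen, each mislabeled with probability one half, so the mean error exceeds
  -- `1/4`.
  obtain ⟨B, hB, hcard⟩ : ∃ B : Finset X, IsShattered F B ∧ 2 * n < B.card := by
    by_contra hcon
    push Not at hcon
    have : vcDim F ≤ ((2 * n : ℕ) : ℕ∞) :=
      iSup₂_le fun B hB => by exact_mod_cast hcon B hB
    rw [htop, top_le_iff] at this
    exact ENat.natCast_ne_top _ this
  let κ := {x // x ∈ B}
  set M := Fintype.card κ with hMdef
  have hM : 2 * n < M := by simpa [hMdef, κ] using hcard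
  have : Nonempty κ := Fintype.card_pos_iff.1 (by omega)
  have hM0 : (0 : ℝ) < M := by exact_mod_cast (by omega : 0 < M)
  choose f hf hfz using hB
  let c : (κ → Bool) → X → Bool := fun z => f fun x => if h : x ∈ B then z ⟨x, h⟩ else false
  have hcF : ∀ z, c z ∈ F := fun z => hf _
  have hcz : ∀ z (y : κ), c z y = z y := by
    intro z y
    simp only [c]
    rw [hfz _ _ y.2]
    simp
  let μ : PMF X := PMF.map (Subtype.val : κ → X) (PMF.uniformOfFintype κ)
  let db : (Fin n → κ) → (κ → Bool) → Database X n := fun x z t => (x t, some (z (x t)))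
  let W : (Fin n → κ) → (κ → Bool) → κ → ℝ≥0∞ := fun x z y =>
    expect (A (db x z)) fun g => ind (g y ≠ z y)
  have hupper : ∀ z, (expect (iid (PMF.uniformOfFintype κ) n) fun x => ∑ y, W x z y) ≤
      M * ENNReal.ofReal (α + β) := by
    intro z
    have hacc := hA (c z) (hcF z) μ
    have hlab : ∀ x : Fin n → κ, labelFirst n (c z) (fun i => (x i : X)) = db x z := by
      intro x; ext1 t; simp [labelFirst, db, hcz]
    simp only [outputDist, μ, iid_map, toOuterMeasure_bind_eq, expect_map, hlab] at hacc
    have hx : ∀ x : Fin n → κ, (∑ y, W x z y) ≤ M * (ENNReal.ofReal α +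
        (A (db x z)).toOuterMeasure {h | ENNReal.ofReal α < genError μ (c z) h}) := by
      intro x
      have hcount : ∀ g : X → Bool, (∑ y : κ, ind (g y ≠ z y)) = M * genError μ (c z) g := by
        intro g
        have hm : M * err μ (c z) g = count fun y : κ => g y ^^ c z y :=
          mass_map_uniform (Subtype.val : κ → X) fun x => g x ^^ c z x
        rw [genError_eq, ← ENNReal.ofReal_natCast, ← ENNReal.ofReal_mul hM0.le, hm, count,
          ENNReal.ofReal_sum_of_nonneg fun _ _ => bval_nonneg _]
        refine Finset.sum_congr rfl fun y _ => ?_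
        rw [hcz]
        cases g y <;> cases z y <;> simp [ind, bval]
      simp only [W]
      rw [← expect_finset_sum]
      simp only [hcount]
      have hadd : ENNReal.ofReal α +
          (A (db x z)).toOuterMeasure {h | ENNReal.ofReal α < genError μ (c z) h} =
          expect (A (db x z)) fun g =>
            ENNReal.ofReal α + ind (ENNReal.ofReal α < genError μ (c z) g) := by
        rw [toOuterMeasure_eq_expect, expect_add, expect_const]
        rfl
      rw [expect_const_mul, hadd]
      refine mul_le_mul_right (expect_mono _ fun g => ?_) _
      by_cases hlt : ENNReal.ofReal α < genError μ (c z) g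
      · rw [ind_true hlt]
        exact (toOuterMeasure_le_one _ _).trans le_add_self
      · exact (not_lt.1 hlt).trans le_self_add
    refine (expect_mono _ hx).trans ?_
    rw [expect_const_mul, expect_add, expect_const, ENNReal.ofReal_add hα hβ]
    gcongr
  have hlower : ∀ x : Fin n → κ, ((M - n : ℕ) : ℝ≥0∞) * 2 ^ M ≤ 2 * ∑ z, ∑ y, W x z y := by
    intro x
    -- Flipping the label of an unseen point leaves the database unchanged, so exactly one of the
    -- two labels is an error.
    have hy : ∀ y, y ∉ Set.range x → 2 * ∑ z, W x z y = 2 ^ M := by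
      intro y hy
      have hflip : (∑ z, W x z y) = ∑ z, W x (flipAt y z) y :=
        ((flipAt y).sum_comp fun z => W x z y).symm
      have hone : ∀ z, W x z y + W x (flipAt y z) y = 1 := by
        intro z
        have hdb : db x (flipAt y z) = db x z := by
          ext1 t
          simp only [db]
          rw [flipAt_of_ne fun h => hy ⟨t, h⟩]
        simp only [W, hdb]
        rw [← expect_add, ← expect_const (A (db x z)) 1]
        refine congrArg _ (funext fun g => ?_)
        simp only [flipAt, Equiv.coe_fn_mk, Function.update_self]
        cases g y <;> cases z y <;> simp [ind]
      rw [two_mul]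
      nth_rw 2 [hflip]
      rw [← Finset.sum_add_distrib, Finset.sum_congr rfl fun z _ => hone z]
      simp [hMdef]
    rw [Finset.sum_comm, Finset.mul_sum]
    have hsub : M - n ≤ (Finset.univ.filter fun y : κ => y ∉ Set.range x).card := by
      have h1 : (Finset.univ.image x).card ≤ n := by
        simpa using Finset.card_image_le (s := Finset.univ) (f := x)
      have h2 : (Finset.univ.filter fun y : κ => y ∉ Set.range x) = (Finset.univ.image x)ᶜ := by
        ext y; simp
      rw [h2, Finset.card_compl]
      omega
    calc ((M - n : ℕ) : ℝ≥0∞) * 2 ^ M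
        ≤ ((Finset.univ.filter fun y : κ => y ∉ Set.range x).card : ℝ≥0∞) * 2 ^ M := by
          gcongr
      _ = ∑ y ∈ Finset.univ.filter fun y : κ => y ∉ Set.range x, 2 * ∑ z, W x z y := by
          rw [Finset.sum_congr rfl fun y hy' => hy y (by simpa using hy')]
          rw [Finset.sum_const, nsmul_eq_mul]
      _ ≤ _ := Finset.sum_le_sum_of_subset (Finset.filter_subset _ _)
  have hfinal : ((M - n : ℕ) : ℝ≥0∞) * 2 ^ M ≤ 2 * (2 ^ M * (M * ENNReal.ofReal (α + β))) := by
    calc ((M - n : ℕ) : ℝ≥0∞) * 2 ^ M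
        = expect (iid (PMF.uniformOfFintype κ) n) fun _ => ((M - n : ℕ) : ℝ≥0∞) * 2 ^ M :=
          (expect_const _ _).symm
      _ ≤ expect (iid (PMF.uniformOfFintype κ) n) fun x => 2 * ∑ z, ∑ y, W x z y :=
          expect_mono _ hlower
      _ = 2 * ∑ z, expect (iid (PMF.uniformOfFintype κ) n) fun x => ∑ y, W x z y := by
          rw [expect_const_mul, expect_finset_sum]
      _ ≤ 2 * ∑ z : κ → Bool, M * ENNReal.ofReal (α + β) := by
          gcongr with z
          exact hupper z
      _ = _ := by simp [hMdef]
  have hreal : ((M - n : ℕ) : ℝ) * 2 ^ M ≤ 2 * (2 ^ M * (M * (α + β))) := by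
    rw [← ENNReal.ofReal_le_ofReal_iff (by positivity), ENNReal.ofReal_mul (by positivity),
      ENNReal.ofReal_mul (by positivity), ENNReal.ofReal_mul (by positivity),
      ENNReal.ofReal_mul (by positivity), ENNReal.ofReal_pow (by norm_num)]
    simpa using hfinal
  rw [Nat.cast_sub (by omega)] at hreal
  have h2M : (0 : ℝ) < 2 ^ M := by positivity
  have h1 : (M : ℝ) - n ≤ 2 * (M * (α + β)) := by
    refine le_of_mul_le_mul_right ?_ h2M
    linarith
  have h2 : 2 * (n : ℝ) < M := by exact_mod_cast hM
  nlinarith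

/-! ### Degenerate cases and choice of parameters. -/

theorem CompetesWith.mono {X : Type*} {n m : ℕ} {F : Set (X → Bool)} {B : Learner X n}
    {α α' β β' : ℝ} (h : CompetesWith α β m F B) (hα : α ≤ α') (hβ : β ≤ β') :
    CompetesWith α' β' m F B := by
  intro c μ
  refine (ENNReal.ofReal_le_ofReal (by linarith)).trans ((h c μ).trans ?_)
  refine toOuterMeasure_mono' _ fun g hg => ?_
  exact le_trans (show genError μ c g ≤ _ from hg) (by gcongr)

theorem const_isDP {X : Type*} {n : ℕ} {ε δ : ℝ} (hε : 0 ≤ ε) (f : X → Bool) :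
    IsDP ε δ (fun _ => PMF.pure f : Learner X n) := by
  intro S T _ E
  refine le_trans ?_ le_self_add
  calc (PMF.pure f).toOuterMeasure E = 1 * (PMF.pure f).toOuterMeasure E := (one_mul _).symm
    _ ≤ _ := by gcongr; simpa using hε

theorem const_competesWith {X : Type*} {n m : ℕ} {F : Set (X → Bool)} {α β : ℝ} (f : X → Bool)
    (h : 1 ≤ β ∨ 0 ≤ β ∧ ∀ c μ, genError μ c f ≤ (⨅ f ∈ F, genError μ c f) + ENNReal.ofReal α) :
    CompetesWith α β m F (fun _ => PMF.pure f : Learner X n) := by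
  intro c μ
  rcases h with h | ⟨hβ, h⟩
  · rw [ENNReal.ofReal_of_nonpos (by linarith)]
    exact zero_le
  · rw [outputDist, PMF.bind_const, PMF.toOuterMeasure_pure_apply,
      if_pos (Set.mem_ofPred_eq ▸ h c μ)]
    rw [← ENNReal.ofReal_one]
    exact ENNReal.ofReal_le_ofReal (by linarith)

theorem eq_of_vcDim_eq_zero {X : Type*} {F : Set (X → Bool)} (h : vcDim F = 0) {f g : X → Bool}
    (hf : f ∈ F) (hg : g ∈ F) : f = g := by
  by_contra hne
  obtain ⟨x, hx⟩ := Function.ne_iff.1 hne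
  have hsh : IsShattered F {x} := by
    intro z
    by_cases hz : f x = z x
    · exact ⟨f, hf, by simpa using hz⟩
    · refine ⟨g, hg, ?_⟩
      simp only [Finset.mem_singleton, forall_eq]
      revert hx hz
      cases f x <;> cases g x <;> cases z x <;> simp
  have := card_le_vcDim hsh
  rw [h] at this
  simp at this

/-- The least `L ≥ 1` that works. Level 1 is always present because the agnostic step relabels `2s`
points; otherwise minimality bounds the largest block by `4n`. -/
theorem exists_level {s n : ℕ} (hs : 0 < s) :
    ∃ L, 1 ≤ L ∧ 2 * n ≤ s * 2 ^ L ∧ (L = 1 ∨ s * 2 ^ L ≤ 4 * n) := by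
  by_cases h : 2 * n ≤ s * 2 ^ 1
  · exact ⟨1, le_rfl, h, Or.inl rfl⟩
  have hex : ∃ L, 2 * n ≤ s * 2 ^ L := by
    refine ⟨2 * n, ?_⟩
    have := (Nat.lt_two_pow_self (n := 2 * n)).le
    nlinarith
  classical
  have hspec := Nat.find_spec hex
  rcases hL : Nat.find hex with _ | L
  · rw [hL] at hspec
    omega
  · rw [hL] at hspec
    refine ⟨L + 1, by omega, hspec, Or.inr ?_⟩
    have := Nat.find_min hex (m := L) (by omega)
    rw [pow_succ, ← mul_assoc]
    omega

/-- The main case: a nonempty class of finite positive VC dimension, and small parameters. -/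
theorem exists_agnostic_learner {X : Type*} {F : Set (X → Bool)} (hF : F.Nonempty) {d n : ℕ}
    (hd0 : 0 < d) (hd : vcDim F ≤ d) {α β ε δ : ℝ} (hα : 0 < α) (hα1 : α < 1 / 100) (hβ : 0 < β)
    (hβ1 : β < 1 / 100) (hε : 0 < ε) (hε1 : ε ≤ 1) {A : Learner X n}
    (hA : IsPSSL α β 1 δ n F A) :
    ∃ (m u : ℕ) (B : Learner X (m + u)),
      (m : ℝ) ≤ 200000 * (Real.log (1 / (α * β)) / (α ^ 2 * ε)) * d ∧
      (u : ℝ) ≤ 200000 * (n / ε) ∧ IsDP ε δ B ∧ CompetesWith (100 * α) (100 * β) m F B ∧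
      OutputsIn (⋃ S, (A S).support) B := by
  set l := Real.log (1 / (α * β)) with hldef
  have hαβ : 0 < α * β := mul_pos hα hβ
  have hexpl : Real.exp l = 1 / (α * β) := Real.exp_log (by positivity)
  have hl : 4000 ≤ Real.exp l := by
    rw [hexpl, le_div_iff₀ hαβ]
    nlinarith
  have hl1 : 1 ≤ l := by
    rw [← Real.exp_le_exp]
    linarith [Real.exp_one_lt_d9]
  have hlα : 1 / α ≤ Real.exp l := by
    rw [hexpl]
    gcongr
    nlinarith
  have hlβ : 1 / β ≤ Real.exp l := by
    rw [hexpl]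
    gcongr
    nlinarith
  have hd1 : (1 : ℝ) ≤ d := by exact_mod_cast hd0
  have hdl : (d : ℝ) ≤ d * l := by nlinarith
  -- The factor 1000 beats the exponents `/12` and `/16` against the growth bound `exp(d(4l + i))`;
  -- rounding up at most doubles `y`.
  set y : ℝ := 1000 * d * l / α ^ 2 with hy
  have hα2 : α ^ 2 ≤ 1 := by nlinarith
  have hy1 : 1000 * d ≤ y := by
    rw [hy, le_div_iff₀ (by positivity)]
    nlinarith
  set s := ⌈y⌉₊ with hsdef
  have hys : y ≤ s := Nat.le_ceil y
  have hsy : (s : ℝ) ≤ 2000 * d * l / α ^ 2 := by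
    have h1 : (s : ℝ) < y + 1 := Nat.ceil_lt_add_one (by linarith)
    have h2 : 2000 * d * l / α ^ 2 = 2 * y := by rw [hy]; ring
    linarith
  have hs1 : d ≤ s := by
    have : (d : ℝ) ≤ s := by linarith
    exact_mod_cast this
  have hs2 : 1000 * d * l ≤ α ^ 2 * s := by
    rw [hy, div_le_iff₀ (by positivity)] at hys
    linarith
  have hs8 : 8 ≤ α ^ 2 * s := by nlinarith
  have hαs : α ^ 2 * s ≤ α * s := by
    gcongr
    nlinarith
  have hkey := two_mul_growth_sq_mul_exp_le hd0 hα (by linarith) hβ hl1 hl hlα hlβ hs1 hsy hs2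
  obtain ⟨L, hL1, hnL, hL⟩ := exists_level (s := s) (n := n) (by omega)
  obtain ⟨ρ, _, alg, hcard, halg⟩ := exists_isRobustLearner hF hd hα hβ.le hA (by linarith) hkey hnL
    (L - 1) 1 (by omega)
  set r := Fintype.card ρ
  have halg' := halg.reindex (Fintype.equivFin ρ)
  set k := ⌈32 / ε⌉₊ with hkdef
  have hk : 32 / ε ≤ k := Nat.le_ceil _
  have hkε : 32 ≤ k * ε := by rwa [div_le_iff₀ hε] at hk
  have hk32 : (32 : ℝ) ≤ k := by
    refine le_trans ?_ hk
    rw [le_div_iff₀ hε]; linarith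
  have hk33 : (k : ℝ) ≤ 33 / ε := by
    have h1 : (k : ℝ) < 32 / ε + 1 := Nat.ceil_lt_add_one (by positivity)
    have h2 : 1 ≤ 1 / ε := by rw [le_div_iff₀ hε]; linarith
    have h3 : 33 / ε = 32 / ε + 1 / ε := by ring
    linarith
  have : NeZero k := ⟨by rintro h; rw [h] at hk32; norm_num at hk32⟩
  obtain ⟨B, hBdp, hBc, hBo⟩ := exists_learner_of_isRobustLearner (k := k) (q := ⌊α * s⌋₊)
    (ε := ε) (b₁ := β) hF (by ring) hkε hk32 hα (by positivity) (by positivity) hβ.le halg' hd hs8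
    (Nat.floor_le (by positivity))
    (by
      rw [← ENNReal.ofReal_natCast, ← ENNReal.ofReal_mul (by positivity),
        show (2 : ℝ≥0∞) = ENNReal.ofReal 2 by simp, ← ENNReal.ofReal_mul (by norm_num)]
      refine ENNReal.ofReal_le_ofReal ?_
      rw [← mul_assoc]
      exact two_mul_growth_mul_exp_le hd0 hα hβ hl1 hl hlα hlβ hs1 hsy hs2)
    (by
      refine le_trans (mul_le_mul_right (inv_two_pow_floor_le _) _) ?_
      rw [← ENNReal.ofReal_natCast, ← ENNReal.ofReal_mul (by positivity)]
      refine ENNReal.ofReal_le_ofReal ?_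
      have h0 := hkey 0
      simp only [pow_zero, mul_one, Nat.cast_zero, zero_add, div_one] at h0
      refine le_trans ?_ h0
      have hG1 : (1 : ℝ) ≤ growth d (2 * s) := by exact_mod_cast one_le_growth _ _
      rw [← mul_assoc, mul_comm _ (2 : ℝ)]
      refine mul_le_mul (mul_le_mul_of_nonneg_left ?_ zero_le_two) (Real.exp_le_exp.2 ?_)
        (Real.exp_pos _).le (by positivity)
      · nlinarith
      · nlinarith)
  refine ⟨_, _, B, ?_, ?_, hBdp, hBc.mono ?_ ?_, hBo⟩
  · push_cast
    calc ((s : ℝ) + s * 2) * k ≤ 3 * (2000 * d * l / α ^ 2) * (33 / ε) := by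
          rw [show (s : ℝ) + s * 2 = 3 * s by ring]
          gcongr
      _ = 198000 * (l / (α ^ 2 * ε)) * d := by field_simp; norm_num1
      _ ≤ _ := by gcongr; norm_num
  · have hr : (r : ℝ) ≤ 8 * n := by
      have : r ≤ 8 * n := by
        rcases hL with rfl | hL
        · omega
        · rw [pow_succ 2 L, ← mul_assoc] at hcard
          omega
      exact_mod_cast this
    push_cast
    calc (r : ℝ) * k ≤ 8 * n * (33 / ε) := by gcongr
      _ = 264 * (n / ε) := by ring
      _ ≤ _ := by gcongr; norm_num
  · push_cast; linarith
  · linarith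

end PrivateLearning

theorem mainTheorem12 :
    ∃ lam K : ℝ, 0 < lam ∧ 0 < K ∧
      ∀ (X : Type*) (F : Set (X → Bool)) (α β ε δ : ℝ) (n : ℕ),
        0 < α → α < 1 → 0 < β → β < 1 → 0 < ε → ε ≤ 1 → 0 ≤ δ →
        ∀ A : Learner X n, IsPSSL α β 1 δ n F A →
          ∃ (m u : ℕ) (B : Learner X (m + u)),
            (m : ENNReal) ≤
              ENNReal.ofReal (K * (Real.log (1 / (α * β)) / (α ^ 2 * ε))) * (vcDim F : ENNReal) ∧
            (u : ℝ) ≤ K * (n / ε) ∧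
            IsDP ε δ B ∧
            CompetesWith (lam * α) (lam * β) m F B ∧
            (OutputsIn F A → IsAgnosticPSSL (lam * α) (lam * β) ε δ m F B) := by
  refine ⟨100, 200000, by norm_num, by norm_num, ?_⟩
  intro X F α β ε δ n hα hα1 hβ hβ1 hε hε1 hδ A hA
  rcases F.eq_empty_or_nonempty with rfl | hF
  · have hdp : IsDP ε δ (fun _ => PMF.pure fun _ => false : Learner X (0 + n)) :=
      const_isDP hε.le _
    have hcomp : CompetesWith (100 * α) (100 * β) 0 ∅
        (fun _ => PMF.pure fun _ => false : Learner X (0 + n)) :=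
      const_competesWith _ (Or.inr ⟨by positivity, fun c μ => by simp⟩)
    -- Over the empty class the infimum is `∞`. The choice `u = n` supplies, from any database for
    -- `B`, one for `A`, whose nonempty support contradicts properness.
    refine ⟨0, n, _, by simp, ?_, hdp, hcomp, fun hout => ⟨⟨fun S => ?_, hcomp⟩, hdp⟩⟩
    · have : (n : ℝ) ≤ n / ε := by
        rw [le_div_iff₀ hε]
        nlinarith [(Nat.cast_nonneg n : (0 : ℝ) ≤ n)]
      have h0 : (0 : ℝ) ≤ n / ε := by positivity
      linarith
    · obtain ⟨h, hh⟩ := (A fun i => S (Fin.natAdd 0 i)).support_nonempty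
      exact absurd (hout _ hh) (Set.notMem_empty h)
  have hconst : ∀ f ∈ F, (1 ≤ 100 * β ∨ 0 ≤ 100 * β ∧ ∀ c μ,
      genError μ c f ≤ (⨅ f ∈ F, genError μ c f) + ENNReal.ofReal (100 * α)) →
      ∃ (m u : ℕ) (B : Learner X (m + u)),
        (m : ENNReal) ≤ ENNReal.ofReal (200000 * (Real.log (1 / (α * β)) / (α ^ 2 * ε))) *
          (vcDim F : ENNReal) ∧
        (u : ℝ) ≤ 200000 * (n / ε) ∧
        IsDP ε δ B ∧
        CompetesWith (100 * α) (100 * β) m F B ∧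
        (OutputsIn F A → IsAgnosticPSSL (100 * α) (100 * β) ε δ m F B) := by
    intro f hf h
    have hdp : IsDP ε δ (fun _ => PMF.pure f : Learner X (0 + 0)) := const_isDP hε.le f
    have hcomp : CompetesWith (100 * α) (100 * β) 0 F (fun _ => PMF.pure f : Learner X (0 + 0)) :=
      const_competesWith f h
    refine ⟨0, 0, _, by simp, ?_, hdp, hcomp, fun _ => ⟨⟨fun S => ?_, hcomp⟩, hdp⟩⟩
    · simp only [Nat.cast_zero]
      positivity
    · simpa using hf
  obtain ⟨f, hf⟩ := hF
  by_cases hαs : 1 ≤ 100 * α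
  · refine hconst f hf (Or.inr ⟨by positivity, fun c μ => ?_⟩)
    refine (toOuterMeasure_le_one μ _).trans (le_trans ?_ le_add_self)
    rw [ENNReal.one_le_ofReal]
    exact hαs
  by_cases hβs : 1 ≤ 100 * β
  · exact hconst f hf (Or.inl hβs)
  -- Infinite VC dimension would make only the bound on `m` vacuous, not the one on `u`; it is
  -- excluded because `α + β < 1/50` here.
  obtain ⟨d, hd⟩ := ENat.ne_top_iff_exists.1
    (vcDim_ne_top hα.le hβ.le (by linarith) hA.1)
  rcases Nat.eq_zero_or_pos d with rfl | hd0
  · refine hconst f hf (Or.inr ⟨by positivity, fun c μ => ?_⟩)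
    refine le_trans (le_iInf₂ fun g hg => ?_) le_self_add
    rw [eq_of_vcDim_eq_zero hd.symm hf hg]
  obtain ⟨m, u, B, hm, hu, hdp, hcomp, hout⟩ := exists_agnostic_learner ⟨f, hf⟩ hd0 hd.ge hα
    (by linarith) hβ (by linarith) hε hε1 hA
  refine ⟨m, u, B, ?_, hu, hdp, hcomp, fun hA' => ⟨⟨fun S => ?_, hcomp⟩, hdp⟩⟩
  · rw [← hd, ENat.toENNReal_coe, ← ENNReal.ofReal_natCast, ← ENNReal.ofReal_natCast,
      ← ENNReal.ofReal_mul']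
    · exact ENNReal.ofReal_le_ofReal hm
    · positivity
  · exact (hout S).trans (Set.iUnion_subset hA')
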